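/- Let $k\ge 1$, let $N=\mathbb{C}^k$ with coordinates $\sigma_1,\dots,\sigma_k$, $\partial_h=\partial/\partial\sigma_h$, and let $D_N$ be the sheaf of holomorphic differential operators on $N$. Put $E=\sum_{h=1}^k\sigma_h\partial_h$ and $U_0=\sum_{h=1}^k h\,\sigma_h\partial_h$. For $\mu\in\mathbb{C}$ let $\mathcal{I}_\mu\subset D_N$ be the left ideal sheaf generated by the operators $$\partial_p\partial_q-\partial_{p+1}\partial_{q-1}\quad(1\le p\le k-1,\ 2\le q\le k)\qquad\text{and}\qquad \partial_1\partial_{m-1}+\partial_m(E+\mu)\quad(2\le m\le k),$$ and put $\mathcal{M}_\mu=D_N/\mathcal{I}_\mu$. For $\lambda\in\mathbb{C}$ put $\mathcal{N}_{\mu,\lambda}=D_N/(\mathcal{I}_\mu+D_N(U_0-\lambda))$. Then, for all $\mu,\lambda\in\mathbb{C}$, right multiplication by $U_0-\lambda$ induces an injective morphism $\mathscr{H}_{\mu,\lambda}:\mathcal{M}_\mu\to\mathcal{M}_\mu$ of sheaves of left $D_N$-modules, and the sequence of sheaves of left $D_N$-modules $$0\to\mathcal{M}_\mu\xrightarrow{\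 \mathscr{H}_{\mu,\lambda}\ }\mathcal{M}_\mu\xrightarrow{\ q_{\mu,\lambda}\ }\mathcal{N}_{\mu,\lambda}\to 0,$$ where $q_{\mu,\lambda}$ is the obvious quotient map, is exact. -/

import Mathlib

noncomputable section

open CategoryTheory TopologicalSpace Opposite Filter Topology

namespace MuTrace

variable {k : ℕ}

/-! ### Germs of holomorphic functions and of holomorphic differential operators -/

/-- The complex manifold `N = ℂ^k`. The coordinate written `σ_h` for `1 ≤ h ≤ k` is
`fun x => x i` for the `i : Fin k` with `i.val + 1 = h`. -/
abbrev N (k : ℕ) : TopCat.{0} := TopCat.of (Fin k → ℂ)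

/-- The ring `O_{N,x}` of germs at `x` of holomorphic functions. -/
def HolGerm (x : Fin k → ℂ) : Subring (Germ (𝓝 x) ℂ) where
  carrier := {φ | ∃ f : (Fin k → ℂ) → ℂ, AnalyticAt ℂ f x ∧ (f : Germ (𝓝 x) ℂ) = φ}
  mul_mem' := by
    rintro _ _ ⟨f, hf, rfl⟩ ⟨g, hg, rfl⟩
    exact ⟨f * g, hf.mul hg, rfl⟩
  one_mem' := ⟨1, analyticAt_const, rfl⟩
  add_mem' := by
    rintro _ _ ⟨f, hf, rfl⟩ ⟨g, hg, rfl⟩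
    exact ⟨f + g, hf.add hg, rfl⟩
  zero_mem' := ⟨0, analyticAt_const, rfl⟩
  neg_mem' := by
    rintro _ ⟨f, hf, rfl⟩
    exact ⟨-f, hf.neg, rfl⟩

/-- The germ at `x` of a function that is holomorphic near `x`. -/
def HolGerm.of {x : Fin k → ℂ} (f : (Fin k → ℂ) → ℂ) (hf : AnalyticAt ℂ f x) : HolGerm x :=
  ⟨(f : Germ (𝓝 x) ℂ), f, hf, rfl⟩

lemma HolGerm.exists_rep {x : Fin k → ℂ} (φ : HolGerm x) :
    ∃ (f : (Fin k → ℂ) → ℂ) (hf : AnalyticAt ℂ f x), HolGerm.of f hf = φ := by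
  obtain ⟨_, f, hf, rfl⟩ := φ
  exact ⟨f, hf, rfl⟩

/-- The `i`-th partial derivative of a function on `ℂ^k`. -/
def partialFun (i : Fin k) (f : (Fin k → ℂ) → ℂ) : (Fin k → ℂ) → ℂ :=
  fun y => fderiv ℂ f y (Pi.single i 1)

lemma partialFun_analyticAt (i : Fin k) {f : (Fin k → ℂ) → ℂ} {x : Fin k → ℂ}
    (hf : AnalyticAt ℂ f x) : AnalyticAt ℂ (partialFun i f) x :=
  by
  have h : AnalyticAt ℂ (fderiv ℂ f) x := hf.fderiv
  exact ((ContinuousLinearMap.apply ℂ ℂ (Pi.single i 1 : Fin k → ℂ)).analyticAt _).comp h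

lemma partialFun_congr (i : Fin k) {f g : (Fin k → ℂ) → ℂ} {x : Fin k → ℂ}
    (h : f =ᶠ[𝓝 x] g) : partialFun i f =ᶠ[𝓝 x] partialFun i g := by
  filter_upwards [h.fderiv (𝕜 := ℂ)] with y hy
  simp [partialFun, hy]

/-- Multiplication by the germ `a`, as an operator on `O_{N,x}`. -/
def mulOp {x : Fin k → ℂ} (a : HolGerm x) : AddMonoid.End (HolGerm x) :=
  AddMonoidHom.mulLeft a

/-- The partial derivative `∂_i`, as an operator on `O_{N,x}`. -/
def partialOp (x : Fin k → ℂ) (i : Fin k) : AddMonoid.End (HolGerm x) where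
  toFun φ := ⟨Germ.map' (partialFun i) (fun _ _ h => partialFun_congr i h) φ.1, by
    obtain ⟨_, f, hf, rfl⟩ := φ
    exact ⟨partialFun i f, partialFun_analyticAt i hf, rfl⟩⟩
  map_zero' := by
    apply Subtype.ext
    refine Germ.coe_eq.2 (Eventually.of_forall fun y => ?_)
    simp [partialFun]
  map_add' := by
    rintro ⟨_, f, hf, rfl⟩ ⟨_, g, hg, rfl⟩
    apply Subtype.ext
    refine Germ.coe_eq.2 ?_
    filter_upwards [hf.eventually_analyticAt, hg.eventually_analyticAt] with y hy hy'
    have := fderiv_add hy.differentiableAt hy'.differentiableAt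
    exact congrArg (fun l => l (Pi.single i 1)) this

/-- The ring `D_{N,x}` of germs at `x` of holomorphic differential operators: the operators on
`O_{N,x}` generated by the multiplications by germs of holomorphic functions and by the partial
derivatives. -/
def diffOpRing (x : Fin k → ℂ) : Subring (AddMonoid.End (HolGerm x)) :=
  Subring.closure (Set.range mulOp ∪ Set.range (partialOp x))

/-- The ring `D_{N,x}` as a type. -/
def DGerm (x : Fin k → ℂ) : Type := diffOpRing x

instance (x : Fin k → ℂ) : Ring (DGerm x) := inferInstanceAs (Ring (diffOpRing x))

/-! ### The sheaf of rings `D_N` -/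

/-- Multiplication by a holomorphic function on `U`, as a family of germs of operators. -/
def mulFam (U : Opens (N k)) (f : (Fin k → ℂ) → ℂ)
    (hf : AnalyticOnNhd ℂ f (U : Set (Fin k → ℂ))) (x : U) : DGerm x.1 :=
  ⟨mulOp (HolGerm.of f (hf x.1 x.2)), Subring.subset_closure (Or.inl ⟨_, rfl⟩)⟩

/-- The partial derivative `∂_i` on `U`, as a family of germs of operators. -/
def partialFam (U : Opens (N k)) (i : Fin k) (x : U) : DGerm x.1 :=
  ⟨partialOp x.1 i, Subring.subset_closure (Or.inr ⟨i, rfl⟩)⟩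

/-- The differential operators of finite order with coefficients holomorphic on `U`: the ring
generated by the multiplications by holomorphic functions on `U` and by the partial derivatives. -/
def finiteOrderOps (U : Opens (N k)) : Subring (∀ x : U, DGerm x.1) :=
  Subring.closure ({s | ∃ f hf, s = mulFam U f hf} ∪ Set.range (partialFam U))

/-- The ring homomorphism of restriction of families of germs. -/
def restrictFam {U V : Opens (N k)} (i : V ⟶ U) :
    (∀ x : U, DGerm x.1) →+* (∀ x : V, DGerm x.1) where
  toFun s x := s ⟨x.1, i.le x.2⟩
  map_one' := rfl
  map_mul' _ _ := rfl
  map_zero' := rfl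
  map_add' _ _ := rfl

lemma restrictFam_mem {U V : Opens (N k)} (i : V ⟶ U) {s : ∀ x : U, DGerm x.1}
    (hs : s ∈ finiteOrderOps U) : restrictFam i s ∈ finiteOrderOps V := by
  have : finiteOrderOps U ≤ (finiteOrderOps V).comap (restrictFam i) := by
    refine (Subring.closure_le).2 ?_
    rintro s (⟨f, hf, rfl⟩ | ⟨j, rfl⟩)
    · exact Subring.subset_closure (Or.inl ⟨f, fun x hx => hf x (i.le hx), rfl⟩)
    · exact Subring.subset_closure (Or.inr ⟨j, rfl⟩)
  exact this hs

/-- A family of germs of operators is a section of `D_N` if it is locally given by a differential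
operator of finite order with holomorphic coefficients. -/
def isDiffOp (k : ℕ) : TopCat.LocalPredicate fun x : N k => DGerm (k := k) x :=
  TopCat.PrelocalPredicate.sheafify
    { pred := fun {U} s => s ∈ finiteOrderOps U
      res := fun i _ h => restrictFam_mem i h }

/-- The ring `Γ(U, D_N)`. -/
def DSec (U : Opens (N k)) : Subring (∀ x : U, DGerm x.1) where
  carrier := {s | (isDiffOp k).pred s}
  mul_mem' := fun ha hb => TopCat.PrelocalPredicate.sheafify_inductionOn₂' _ _ _
    (fun {_} a b => a * b) (fun {U V _ _} ha hb => mul_mem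
      (restrictFam_mem (Opens.infLELeft U V) ha) (restrictFam_mem (Opens.infLERight U V) hb)) ha hb
  one_mem' := TopCat.PrelocalPredicate.sheafifyOf (one_mem (finiteOrderOps U))
  add_mem' := fun ha hb => TopCat.PrelocalPredicate.sheafify_inductionOn₂' _ _ _
    (fun {_} a b => a + b) (fun {U V _ _} ha hb => add_mem
      (restrictFam_mem (Opens.infLELeft U V) ha) (restrictFam_mem (Opens.infLERight U V) hb)) ha hb
  zero_mem' := TopCat.PrelocalPredicate.sheafifyOf (zero_mem (finiteOrderOps U))
  neg_mem' := fun ha => TopCat.PrelocalPredicate.sheafify_inductionOn' _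
    (fun {_} a => -a) (fun {U _} ha => (neg_mem ha : _ ∈ finiteOrderOps U)) ha

/-- Restriction `Γ(U, D_N) → Γ(V, D_N)`. -/
def DSec.res {U V : Opens (N k)} (i : V ⟶ U) : DSec U →+* DSec V :=
  ((restrictFam i).comp (DSec U).subtype).codRestrict (DSec V)
    (fun s => (isDiffOp k).res i s.1 s.2)

/-- The presheaf of rings underlying `D_N`. -/
def DPresheaf (k : ℕ) : TopCat.Presheaf RingCat.{0} (N k) where
  obj U := RingCat.of (DSec U.unop)
  map i := RingCat.ofHom (DSec.res i.unop)
  map_id _ := rfl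
  map_comp _ _ := rfl

/-- The sheaf of rings `D_N` of holomorphic differential operators on `N = ℂ^k`. -/
def DSheaf (k : ℕ) : Sheaf (Opens.grothendieckTopology (N k)) RingCat.{0} :=
  ⟨DPresheaf k, (TopCat.Presheaf.isSheaf_iff_isSheaf_comp (forget RingCat) (DPresheaf k)).2
    (TopCat.subpresheafToTypes.isSheaf (isDiffOp k))⟩

/-! ### Quotients of `D_N` by left ideals generated by global sections -/

/-- Global sections of `D_N`. -/
abbrev GlobalOp (k : ℕ) : Type := DSec (⊤ : Opens (N k))

/-- The germ at `x` of a global section of `D_N`. -/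
def GlobalOp.germ (P : GlobalOp k) (x : Fin k → ℂ) : DGerm x := P.1 ⟨x, trivial⟩

/-- The stalk at `x` of the left ideal of `D_N` generated by a set `G` of global sections: the left
ideal of `D_{N,x}` generated by their germs. -/
def idealStalk (G : Set (GlobalOp k)) (x : Fin k → ℂ) : Ideal (DGerm x) :=
  Ideal.span ((fun P : GlobalOp k => P.germ x) '' G)

/-- The stalk at `x` of the quotient of `D_N` by the left ideal generated by `G`. -/
def QStalk (G : Set (GlobalOp k)) (x : Fin k → ℂ) : Type := DGerm x ⧸ idealStalk G x

instance (G : Set (GlobalOp k)) (x : Fin k → ℂ) : AddCommGroup (QStalk G x) :=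
  inferInstanceAs (AddCommGroup (DGerm x ⧸ idealStalk G x))

instance (G : Set (GlobalOp k)) (x : Fin k → ℂ) : Module (DGerm x) (QStalk G x) :=
  inferInstanceAs (Module (DGerm x) (DGerm x ⧸ idealStalk G x))

/-- The class in the stalk of the quotient of a germ of differential operator. -/
def QStalk.mk (G : Set (GlobalOp k)) (x : Fin k → ℂ) : DGerm x →ₗ[DGerm x] QStalk G x :=
  (idealStalk G x).mkQ

/-- The family of classes of the germs of a section of `D_N`. -/
def classFam (G : Set (GlobalOp k)) {U : Opens (N k)} (P : DSec U) (x : U) : QStalk G x.1 :=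
  QStalk.mk G x.1 (P.1 x)

/-- The sections of the quotient sheaf: families of elements of the stalks that are locally the
classes of a section of `D_N`. -/
def isQSec (G : Set (GlobalOp k)) : TopCat.LocalPredicate fun x : N k => QStalk G x :=
  TopCat.PrelocalPredicate.sheafify
    { pred := fun {U} s => ∃ P : DSec U, s = classFam G P
      res := by
        rintro U V i _ ⟨P, rfl⟩
        exact ⟨DSec.res i P, rfl⟩ }

/-- Sections of `D_N` over `U` act pointwise on families of elements of the stalks. -/
instance famModule (G : Set (GlobalOp k)) (U : Opens (N k)) :
    Module (DSec U) (∀ x : U, QStalk G x.1) where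
  smul P s x := P.1 x • s x
  one_smul s := funext fun x => one_smul (DGerm x.1) (s x)
  mul_smul P Q s := funext fun x => mul_smul (P.1 x) (Q.1 x) (s x)
  smul_zero P := funext fun x => smul_zero (P.1 x)
  smul_add P s t := funext fun x => smul_add (P.1 x) (s x) (t x)
  add_smul P Q s := funext fun x => add_smul (P.1 x) (Q.1 x) (s x)
  zero_smul s := funext fun x => zero_smul (DGerm x.1) (s x)

lemma famModule_smul_apply (G : Set (GlobalOp k)) {U : Opens (N k)} (P : DSec U)
    (s : ∀ x : U, QStalk G x.1) (x : U) : (P • s) x = P.1 x • s x := rfl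

/-- The `Γ(U, D_N)`-module of sections over `U` of the quotient sheaf. -/
def QSec (G : Set (GlobalOp k)) (U : Opens (N k)) :
    Submodule (DSec U) (∀ x : U, QStalk G x.1) where
  carrier := {s | (isQSec G).pred s}
  add_mem' := fun ha hb => TopCat.PrelocalPredicate.sheafify_inductionOn₂' _ _ _
    (fun {_} a b => a + b) (by
      rintro U V _ _ ⟨P, rfl⟩ ⟨Q, rfl⟩
      exact ⟨DSec.res (Opens.infLELeft U V) P + DSec.res (Opens.infLERight U V) Q, rfl⟩) ha hb
  zero_mem' := TopCat.PrelocalPredicate.sheafifyOf ⟨0, rfl⟩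
  smul_mem' := by
    intro P s hs x
    obtain ⟨V, hV, i, Q, hQ⟩ := hs x
    refine ⟨V, hV, i, DSec.res i P * Q, ?_⟩
    funext y
    have h : s ⟨y.1, i.le y.2⟩ = classFam G Q y := congrFun hQ y
    refine (famModule_smul_apply G P s ⟨y.1, i.le y.2⟩).trans ?_
    rw [h]
    exact ((QStalk.mk G y.1).map_smul (P.1 ⟨y.1, i.le y.2⟩) (Q.1 y)).symm

/-- Restriction of sections of the quotient sheaf. -/
def QSec.res (G : Set (GlobalOp k)) {U V : Opens (N k)} (i : V ⟶ U) : QSec G U →+ QSec G V where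
  toFun s := ⟨fun x => s.1 ⟨x.1, i.le x.2⟩, (isQSec G).res i s.1 s.2⟩
  map_zero' := rfl
  map_add' _ _ := rfl

/-- The abelian presheaf underlying the quotient sheaf. -/
def QPresheaf (G : Set (GlobalOp k)) : TopCat.Presheaf AddCommGrpCat.{0} (N k) where
  obj U := AddCommGrpCat.of (QSec G U.unop)
  map i := AddCommGrpCat.ofHom (QSec.res G i.unop)
  map_id _ := rfl
  map_comp _ _ := rfl

instance (G : Set (GlobalOp k)) (U : (Opens (N k))ᵒᵖ) :
    Module ((DSheaf k).obj.obj U) ((QPresheaf G).obj U) :=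
  inferInstanceAs (Module (DSec U.unop) (QSec G U.unop))

/-- The sheaf of left `D_N`-modules `D_N / (left ideal generated by G)`. -/
def QSheaf (G : Set (GlobalOp k)) : SheafOfModules.{0} (DSheaf k) where
  val := PresheafOfModules.ofPresheaf (QPresheaf G) (fun {U V} i P s => by
    apply Subtype.ext
    funext x
    rfl)
  isSheaf := (TopCat.Presheaf.isSheaf_iff_isSheaf_comp (forget AddCommGrpCat) (QPresheaf G)).2
    (TopCat.subpresheafToTypes.isSheaf (isQSec G))

/-- Right multiplication by `Q` on stalks `D_{N,x} / I_x → D_{N,x} / I'_x`, where `I_x Q ⊆ I'_x`. -/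
def rightMulStalk (G G' : Set (GlobalOp k)) (Q : GlobalOp k)
    (h : ∀ g ∈ G, ∀ x, (g * Q).germ x ∈ idealStalk G' x) (x : Fin k → ℂ) :
    QStalk G x →ₗ[DGerm x] QStalk G' x :=
  Submodule.mapQ _ _ (LinearMap.toSpanSingleton (DGerm x) (DGerm x) (Q.germ x)) (by
    refine Submodule.span_le.2 ?_
    rintro _ ⟨g, hg, rfl⟩
    exact h g hg x)

/-- The `D_N`-linear map `D_N / I → D_N / I'` given by right multiplication by the global operator
`Q`, where `I` and `I'` are generated by `G` and `G'` and `I Q ⊆ I'`. -/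
def rightMul (G G' : Set (GlobalOp k)) (Q : GlobalOp k)
    (h : ∀ g ∈ G, ∀ x, (g * Q).germ x ∈ idealStalk G' x) : QSheaf G ⟶ QSheaf G' where
  val := PresheafOfModules.homMk
    { app := fun U => AddCommGrpCat.ofHom
        { toFun := fun (s : QSec G U.unop) => (⟨fun x => rightMulStalk G G' Q h x.1 (s.1 x), by
            intro x
            obtain ⟨V, hV, i, P, hP⟩ := s.2 x
            refine ⟨V, hV, i, P * DSec.res (homOfLE le_top) Q, ?_⟩
            funext y
            exact congrArg (rightMulStalk G G' Q h y.1) (congrFun hP y)⟩ : QSec G' U.unop)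
          map_zero' := Subtype.ext (funext fun x => map_zero _)
          map_add' := fun s t => Subtype.ext (funext fun x => map_add _ _ _) }
      naturality := fun _ _ _ => rfl }
    (fun U (P : DSec U.unop) (s : QSec G U.unop) => Subtype.ext (funext fun x => map_smul _ (P.1 x) (s.1 x)))

/-- `D_N / I → D_N / I'` applied to a section, stalk by stalk. -/
lemma rightMul_app_apply (G G' : Set (GlobalOp k)) (Q : GlobalOp k)
    (h : ∀ g ∈ G, ∀ x, (g * Q).germ x ∈ idealStalk G' x) (U : (Opens (N k))ᵒᵖ)
    (s : QSec G U.unop) (x : U.unop) :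
    ((rightMul G G' Q h).val.app U s : QSec G' U.unop).1 x =
      rightMulStalk G G' Q h x.1 (s.1 x) := rfl

/-! ### The operators `∂_h`, `σ_h`, `E`, `U_0`, `A_{i,j}`, `T^m_μ` -/

namespace GlobalOp

/-- Multiplication by an entire function. -/
def mulBy (f : (Fin k → ℂ) → ℂ) (hf : AnalyticOnNhd ℂ f Set.univ) : GlobalOp k :=
  ⟨mulFam ⊤ f (fun x _ => hf x trivial), TopCat.PrelocalPredicate.sheafifyOf
    (Subring.subset_closure (Or.inl ⟨f, fun x _ => hf x trivial, rfl⟩))⟩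

/-- The partial derivative `∂_h = ∂/∂σ_h`, `h = i + 1`. -/
def d (i : Fin k) : GlobalOp k :=
  ⟨partialFam ⊤ i, TopCat.PrelocalPredicate.sheafifyOf (Subring.subset_closure (Or.inr ⟨i, rfl⟩))⟩

/-- Multiplication by the coordinate `σ_h`, `h = i + 1`. -/
def σ (i : Fin k) : GlobalOp k :=
  mulBy (fun y => y i)
    (fun x _ => (ContinuousLinearMap.proj (R := ℂ) (φ := fun _ : Fin k => ℂ) i).analyticAt x)

/-- Multiplication by the constant `c`. -/
def C (c : ℂ) : GlobalOp k := mulBy (fun _ => c) (fun _ _ => analyticAt_const)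

variable (k) in
/-- The Euler vector field `E = ∑_{h=1}^k σ_h ∂_h`. -/
def E : GlobalOp k := ∑ i, σ i * d i

variable (k) in
/-- The vector field `U_0 = ∑_{h=1}^k h σ_h ∂_h`. -/
def U₀ : GlobalOp k := ∑ i : Fin k, ((i.val + 1 : ℕ) : GlobalOp k) * (σ i * d i)

lemma ext_of_rep {P Q : GlobalOp k}
    (h : ∀ x (f : (Fin k → ℂ) → ℂ) (hf : AnalyticAt ℂ f x),
      (P.germ x).1 (HolGerm.of f hf) = (Q.germ x).1 (HolGerm.of f hf)) : P = Q := by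
  apply Subtype.ext
  funext x
  refine Subtype.ext (AddMonoidHom.ext fun φ => ?_)
  obtain ⟨f, hf, rfl⟩ := HolGerm.exists_rep φ
  exact h x.1 f hf

lemma C_comm_d (c : ℂ) (i : Fin k) : C c * d i = d i * C c := by
  refine ext_of_rep fun x f hf => Subtype.ext ?_
  refine Germ.coe_eq.2 ?_
  filter_upwards [hf.eventually_analyticAt] with y hy
  have := fderiv_const_mul hy.differentiableAt c
  exact (congrArg (fun l => l (Pi.single i 1)) this).symm

lemma mulBy_comm (f g : (Fin k → ℂ) → ℂ) (hf : AnalyticOnNhd ℂ f Set.univ)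
    (hg : AnalyticOnNhd ℂ g Set.univ) : mulBy f hf * mulBy g hg = mulBy g hg * mulBy f hf := by
  refine ext_of_rep fun x u hu => Subtype.ext ?_
  refine Germ.coe_eq.2 (Eventually.of_forall fun y => ?_)
  exact mul_left_comm (f y) (g y) (u y)

lemma d_comm (i j : Fin k) : d i * d j = d j * d i := by
  refine ext_of_rep fun x f hf => Subtype.ext ?_
  refine Germ.coe_eq.2 ?_
  filter_upwards [hf.eventually_analyticAt] with y hy
  have h1 : DifferentiableAt ℂ (fderiv ℂ f) y := AnalyticAt.differentiableAt hy.fderiv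
  have h2 : IsSymmSndFDerivAt ℂ f y :=
    ContDiffAt.isSymmSndFDerivAt (n := 2) hy.contDiffAt (by simp)
  have h3 : ∀ v w : Fin k → ℂ, fderiv ℂ (fun z => fderiv ℂ f z v) y w =
      fderiv ℂ (fderiv ℂ f) y w v := by
    intro v w
    rw [fderiv_clm_apply h1 (differentiableAt_const v)]
    simp
  exact (h3 _ _).trans ((h2 _ _).trans (h3 _ _).symm)

lemma d_mul_σ (i j : Fin k) : d i * σ j = σ j * d i + if i = j then 1 else 0 := by
  refine ext_of_rep fun x f hf => ?_
  split_ifs with h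
  · subst h
    refine Subtype.ext (Germ.coe_eq.2 ?_)
    filter_upwards [hf.eventually_analyticAt] with y hy
    have h1 : HasFDerivAt (fun z : Fin k → ℂ => z i)
      (ContinuousLinearMap.proj (R := ℂ) (φ := fun _ : Fin k => ℂ) i) y := hasFDerivAt_apply i y
    have := congrArg (fun l => l (Pi.single i 1)) (h1.mul hy.differentiableAt.hasFDerivAt).fderiv
    refine this.trans ?_
    simp [partialFun]
  · refine Subtype.ext (Germ.coe_eq.2 ?_)
    filter_upwards [hf.eventually_analyticAt] with y hy
    have h1 : HasFDerivAt (fun z : Fin k → ℂ => z j)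
      (ContinuousLinearMap.proj (R := ℂ) (φ := fun _ : Fin k => ℂ) j) y := hasFDerivAt_apply j y
    have := congrArg (fun l => l (Pi.single i 1)) (h1.mul hy.differentiableAt.hasFDerivAt).fderiv
    refine this.trans ?_
    simp [partialFun, Ne.symm h]

/-- `P` has weight `-w` for the adjoint action of `U_0`: `P U_0 = (U_0 + w) P`. -/
def HasWeight (w : ℤ) (P : GlobalOp k) : Prop := P * U₀ k = U₀ k * P + w * P

lemma HasWeight.mul {v w : ℤ} {P Q : GlobalOp k} (hP : HasWeight v P) (hQ : HasWeight w Q) :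
    HasWeight (v + w) (P * Q) := by
  have hw : P * (w : GlobalOp k) = w * P := (Int.cast_commute w P).symm
  unfold HasWeight at *
  rw [mul_assoc, hQ, mul_add, ← mul_assoc, hP, ← mul_assoc, hw]
  push_cast
  noncomm_ring

lemma HasWeight.add {w : ℤ} {P Q : GlobalOp k} (hP : HasWeight w P) (hQ : HasWeight w Q) :
    HasWeight w (P + Q) := by
  unfold HasWeight at *
  rw [add_mul, hP, hQ]
  noncomm_ring

lemma HasWeight.sub {w : ℤ} {P Q : GlobalOp k} (hP : HasWeight w P) (hQ : HasWeight w Q) :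
    HasWeight w (P - Q) := by
  unfold HasWeight at *
  rw [sub_mul, hP, hQ]
  noncomm_ring

lemma hasWeight_d (i : Fin k) : HasWeight (i.val + 1) (d i) := by
  have h : ∀ j : Fin k, d i * (((j.val + 1 : ℕ) : GlobalOp k) * (σ j * d j)) =
      ((j.val + 1 : ℕ) : GlobalOp k) * (σ j * d j) * d i +
        if i = j then ((j.val + 1 : ℕ) : GlobalOp k) * d j else 0 := by
    intro j
    rw [← mul_assoc, ← (Nat.cast_commute _ (d i)).eq, mul_assoc, ← mul_assoc (d i), d_mul_σ,
      add_mul, mul_assoc, d_comm i j]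
    split_ifs <;> noncomm_ring
  unfold HasWeight U₀
  rw [Finset.mul_sum, Finset.sum_congr rfl (fun j _ => h j), Finset.sum_add_distrib,
    Finset.sum_ite_eq, ← Finset.sum_mul]
  simp

lemma hasWeight_σ (i : Fin k) : HasWeight (-(i.val + 1)) (σ i) := by
  have h : ∀ j : Fin k, (((j.val + 1 : ℕ) : GlobalOp k) * (σ j * d j)) * σ i =
      σ i * (((j.val + 1 : ℕ) : GlobalOp k) * (σ j * d j)) +
        if i = j then ((j.val + 1 : ℕ) : GlobalOp k) * σ j else 0 := by
    intro j
    have hσ : σ j * σ i = σ i * σ j := mulBy_comm _ _ _ _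
    rw [mul_assoc, mul_assoc, d_mul_σ, mul_add, ← mul_assoc (σ j), hσ, ← mul_assoc (σ i),
      ← (Nat.cast_commute _ (σ i)).eq, mul_assoc, mul_add, mul_assoc]
    by_cases hij : i = j
    · subst hij; simp
    · simp [hij, Ne.symm hij]
  unfold HasWeight U₀
  rw [Finset.sum_mul, Finset.sum_congr rfl (fun j _ => h j), Finset.sum_add_distrib,
    Finset.sum_ite_eq, ← Finset.mul_sum]
  rw [if_pos (Finset.mem_univ i), add_assoc, ← add_mul]
  simp

lemma hasWeight_E : HasWeight 0 (E k) := by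
  have h : ∀ i : Fin k, HasWeight 0 (σ i * d i) := by
    intro i
    have := (hasWeight_σ i).mul (hasWeight_d i)
    rwa [neg_add_cancel] at this
  unfold HasWeight E
  rw [Finset.sum_mul, Finset.sum_congr rfl (fun i _ => (h i)), Finset.sum_add_distrib,
    ← Finset.mul_sum, ← Finset.mul_sum]

lemma C_comm_natCast_mul (c : ℂ) (n : ℕ) (P : GlobalOp k) (h : C c * P = P * C c) :
    C c * ((n : GlobalOp k) * P) = (n : GlobalOp k) * P * C c := by
  rw [← mul_assoc, ← (Nat.cast_commute n (C c)).eq, mul_assoc, h, mul_assoc]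

lemma C_comm_U₀ (c : ℂ) : C c * U₀ k = U₀ k * C c := by
  unfold U₀
  rw [Finset.mul_sum, Finset.sum_mul]
  refine Finset.sum_congr rfl fun i _ => C_comm_natCast_mul _ _ _ ?_
  have hσ : C c * σ i = σ i * C c := mulBy_comm _ _ _ _
  rw [← mul_assoc, hσ, mul_assoc, C_comm_d, mul_assoc]

lemma hasWeight_C (c : ℂ) : HasWeight 0 (C c : GlobalOp k) := by
  unfold HasWeight
  rw [C_comm_U₀]
  simp

end GlobalOp

/-! ### The modules `M_μ` and `N_{μ,λ}` -/

open GlobalOp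

variable (k) in
/-- The operators `A_{p,q} = ∂_p ∂_q - ∂_{p+1} ∂_{q-1}` for `p ∈ [1, k-1]`, `q ∈ [2, k]`
(here `p = i + 1`, `p + 1 = i' + 1`, `q = j + 1`, `q - 1 = j' + 1`). -/
def genA : Set (GlobalOp k) :=
  {P | ∃ i i' j j' : Fin k, i'.val = i.val + 1 ∧ j.val = j'.val + 1 ∧
    P = d i * d j - d i' * d j'}

variable (k) in
/-- The operators `T^m_μ = ∂_1 ∂_{m-1} + ∂_m (E + μ)` for `m ∈ [2, k]`
(here `1 = o + 1`, `m = j + 1`, `m - 1 = j' + 1`). -/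
def genT (μ : ℂ) : Set (GlobalOp k) :=
  {P | ∃ o j j' : Fin k, o.val = 0 ∧ j.val = j'.val + 1 ∧
    P = d o * d j' + d j * (E k + C μ)}

variable (k) in
/-- The generators of the left ideal `I_μ`. -/
def genI (μ : ℂ) : Set (GlobalOp k) := genA k ∪ genT k μ

variable (k) in
/-- The generators of the left ideal `J_{μ,λ} = I_μ + D_N (U_0 - λ)`. -/
def genJ (μ lam : ℂ) : Set (GlobalOp k) := genI k μ ∪ {U₀ k - C lam}

variable (k) in
/-- The left `D_N`-module `M_μ = D_N / I_μ`. -/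
def moduleM (μ : ℂ) : SheafOfModules.{0} (DSheaf k) := QSheaf (genI k μ)

variable (k) in
/-- The left `D_N`-module `N_{μ,λ} = D_N / (I_μ + D_N (U_0 - λ))`. -/
def moduleN (μ lam : ℂ) : SheafOfModules.{0} (DSheaf k) := QSheaf (genJ k μ lam)

lemma exists_hasWeight_genI (μ : ℂ) {P : GlobalOp k} (hP : P ∈ genI k μ) :
    ∃ w, HasWeight w P := by
  rcases hP with ⟨i, i', j, j', hi, hj, rfl⟩ | ⟨o, j, j', ho, hj, rfl⟩
  · have h1 := (hasWeight_d i).mul (hasWeight_d j)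
    have h2 := (hasWeight_d i').mul (hasWeight_d j')
    have e : ((i'.val : ℤ) + 1 + (j'.val + 1)) = i.val + 1 + (j.val + 1) := by
      rw [hi, hj]; push_cast; ring
    rw [e] at h2
    exact ⟨_, h1.sub h2⟩
  · have h1 := (hasWeight_d o).mul (hasWeight_d j')
    have h2 := (hasWeight_d j).mul (hasWeight_E.add (hasWeight_C μ))
    have e : ((j.val : ℤ) + 1 + 0) = o.val + 1 + (j'.val + 1) := by
      rw [ho, hj]; push_cast; ring
    rw [e] at h2
    exact ⟨_, h1.add h2⟩

lemma C_comm_genI (c μ : ℂ) {P : GlobalOp k} (hP : P ∈ genI k μ) : Commute (C c) P := by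
  have hd : ∀ i : Fin k, Commute (C c) (d i) := C_comm_d c
  have hσ : ∀ i : Fin k, Commute (C c) (σ i) := fun i => mulBy_comm _ _ _ _
  have hC : Commute (C c : GlobalOp k) (C μ) := mulBy_comm _ _ _ _
  have hE : Commute (C c) (E k) :=
    Commute.sum_right _ _ _ fun i _ => (hσ i).mul_right (hd i)
  rcases hP with ⟨i, i', j, j', hi, hj, rfl⟩ | ⟨o, j, j', ho, hj, rfl⟩
  · exact ((hd _).mul_right (hd _)).sub_right ((hd _).mul_right (hd _))
  · exact ((hd _).mul_right (hd _)).add_right ((hd _).mul_right (hE.add_right hC))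

/-- Right multiplication by `U_0 - λ` sends `I_μ` into itself. -/
lemma genI_mul_mem (μ lam : ℂ) (P : GlobalOp k) (hP : P ∈ genI k μ) (x : Fin k → ℂ) :
    (P * (U₀ k - C lam)).germ x ∈ idealStalk (genI k μ) x := by
  obtain ⟨w, hw⟩ := exists_hasWeight_genI μ hP
  have hc := (C_comm_genI lam μ hP).eq
  have e : P * (U₀ k - C lam) = (U₀ k + (w : GlobalOp k) - C lam) * P := by
    rw [mul_sub, hw, ← hc]
    noncomm_ring
  rw [e]
  exact Ideal.mul_mem_left _ ((U₀ k + (w : GlobalOp k) - C lam : GlobalOp k).germ x)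
    (Ideal.subset_span ⟨P, hP, rfl⟩)

lemma genI_mul_one_mem (μ lam : ℂ) (P : GlobalOp k) (hP : P ∈ genI k μ) (x : Fin k → ℂ) :
    (P * 1).germ x ∈ idealStalk (genJ k μ lam) x := by
  rw [mul_one]
  exact Ideal.subset_span ⟨P, Or.inl hP, rfl⟩

variable (k) in
/-- The `D_N`-linear map `M_μ → M_μ` given by right multiplication by `U_0 - λ`. -/
def mapH (μ lam : ℂ) : moduleM k μ ⟶ moduleM k μ :=
  rightMul _ _ (U₀ k - C lam) (genI_mul_mem μ lam)

variable (k) in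
/-- The quotient map `M_μ → N_{μ,λ}`, `[P] ↦ [P]`. -/
def mapq (μ lam : ℂ) : moduleM k μ ⟶ moduleN k μ lam :=
  rightMul _ _ 1 (genI_mul_one_mem μ lam)

lemma mapH_comp_mapq (μ lam : ℂ) : mapH k μ lam ≫ mapq k μ lam = 0 := by
  apply SheafOfModules.hom_ext
  apply PresheafOfModules.hom_ext
  intro U
  ext s
  refine Subtype.ext (funext fun x => ?_)
  have key : ∀ t : QStalk (genI k μ) x.1,
      rightMulStalk _ _ 1 (genI_mul_one_mem μ lam) x.1
        (rightMulStalk _ _ (U₀ k - C lam) (genI_mul_mem μ lam) x.1 t) = 0 := by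
    intro t
    obtain ⟨P, rfl⟩ := Submodule.mkQ_surjective (idealStalk (genI k μ) x.1) t
    refine (Submodule.Quotient.mk_eq_zero (idealStalk (genJ k μ lam) x.1)).2 ?_
    change (P * (U₀ k - C lam).germ x.1) * (1 : GlobalOp k).germ x.1 ∈ _
    have h1 : (1 : GlobalOp k).germ x.1 = 1 := rfl
    rw [h1, mul_one]
    exact Ideal.mul_mem_left _ P (Ideal.subset_span ⟨_, Or.inr rfl, rfl⟩)
  exact key (s.1 x)

variable (k) in
/-- The sequence `M_μ → M_μ → N_{μ,λ}` of sheaves of left `D_N`-modules. -/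
def sequenceMMN (μ lam : ℂ) : ShortComplex (SheafOfModules.{0} (DSheaf k)) :=
  ShortComplex.mk (mapH k μ lam) (mapq k μ lam) (mapH_comp_mapq μ lam)

end MuTrace

end

noncomputable section

open CategoryTheory TopologicalSpace Opposite Filter Topology

namespace MuTrace

variable {k : ℕ}

/-! Everything reduces to injectivity on stalks: if `P (U_0 - λ)` lies in the stalk of `I_μ`, so
does `P`. Write `O` for the ring of germs. Total symbols identify `D_{N,x}` with `O[ζ]`
(`ofSymbol_injective`, `ofSymbol_surjective`). On symbols, right multiplication by `∂_i` is
multiplication by `ζ_i`, and right multiplication by `σ_i` is `r ↦ σ_i r + ∂r/∂ζ_i`.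

The map `ζ_h ↦ c t^h` to `O[t][c]` kills exactly the ideal generated by the symbols of the
`A_{p,q}`. Put `Q = 1 + ∑ σ_h t^h`. In this model the multiples of the `T^m_μ` become the elements
`(c Q + c ∂_c + μ) w`, with `w` spanned by monomials `c^q t^s`, `q + 1 ≤ s ≤ k q`, and right
multiplication by `U_0 - λ` becomes `c t Q' + t ∂_t - λ`. The two operators commute
(`eulerOp_relOp`).

Suppose `(c t Q' + t ∂_t - λ) v = (c Q + c ∂_c + μ) w`, where `v` has degree at most `p` in `c`. The
coefficients of `c^(p+1)` give `t Q' v_p = Q w_p`. The resultant of `Q` and `t Q'` is a nonzero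
polynomial in `σ`, and `Q(0) = 1`, so `Q` divides `v_p`. Subtracting the relation attached to
`c^(p-1) v_p / Q` lowers the degree in `c`, and induction shows that `v` is a relation
(`exists_relOp_of_eulerOp`).

For the passage to sheaves, membership in the ideal is an open condition
(`exists_forall_mem_idealStalk`). The preimages under `U_0 - λ`, unique on each stalk, therefore
glue to sections, which makes the first map a kernel of the second. -/

/-! ### The total symbol of a differential operator -/

section Symbol

variable {x : Fin k → ℂ}

/-- The embedding of `O_{N,x}` in `D_{N,x}`. -/
def mulHom (x : Fin k → ℂ) : HolGerm x →+* DGerm x where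
  toFun a := ⟨mulOp a, Subring.subset_closure (Or.inl ⟨a, rfl⟩)⟩
  map_one' := Subtype.ext (AddMonoidHom.ext fun φ => one_mul φ)
  map_mul' a b := Subtype.ext (AddMonoidHom.ext fun φ => mul_assoc a b φ)
  map_zero' := Subtype.ext (AddMonoidHom.ext fun φ => zero_mul φ)
  map_add' a b := Subtype.ext (AddMonoidHom.ext fun φ => add_mul a b φ)

/-- The germ of `∂_i` at `x`. -/
def dGerm (x : Fin k → ℂ) (i : Fin k) : DGerm x :=
  ⟨partialOp x i, Subring.subset_closure (Or.inr ⟨i, rfl⟩)⟩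

lemma partialOp_mul (i : Fin k) (a b : HolGerm x) :
    partialOp x i (a * b) = a * partialOp x i b + b * partialOp x i a := by
  obtain ⟨f, hf, rfl⟩ := HolGerm.exists_rep a
  obtain ⟨g, hg, rfl⟩ := HolGerm.exists_rep b
  refine Subtype.ext (Germ.coe_eq.2 ?_)
  filter_upwards [hf.eventually_analyticAt, hg.eventually_analyticAt] with y hy hy'
  have := congrArg (fun l => l (Pi.single i 1))
    (hy.differentiableAt.hasFDerivAt.mul hy'.differentiableAt.hasFDerivAt).fderiv
  refine this.trans ?_
  simp [partialFun]

/-- The derivation `∂_i` of `O_{N,x}`. -/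
def partialDer (x : Fin k → ℂ) (i : Fin k) : Derivation ℤ (HolGerm x) (HolGerm x) :=
  Derivation.mk' (partialOp x i).toIntLinearMap (fun a b => partialOp_mul i a b)

lemma dGerm_mul_mulHom (i : Fin k) (a : HolGerm x) :
    dGerm x i * mulHom x a = mulHom x a * dGerm x i + mulHom x (partialDer x i a) := by
  refine Subtype.ext (AddMonoidHom.ext fun φ => ?_)
  exact (partialOp_mul i a φ).trans (congrArg _ (mul_comm _ _))

lemma dGerm_comm (i j : Fin k) : dGerm x i * dGerm x j = dGerm x j * dGerm x i :=
  congrArg (fun P : GlobalOp k => P.germ x) (GlobalOp.d_comm i j)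

instance : Module (HolGerm x) (DGerm x) := Module.compHom _ (mulHom x)

lemma smul_eq_mulHom (f : HolGerm x) (P : DGerm x) : f • P = mulHom x f * P := rfl

/-- Polynomials in the `∂_i` with integral coefficients. -/
def dPoly (x : Fin k → ℂ) : MvPolynomial (Fin k) ℤ →+* DGerm x :=
  -- `DGerm x` is not commutative, so polynomials are evaluated in the subring generated by the
  -- `∂_i`, which is.
  haveI := Subring.isMulCommutative_closure (s := Set.range (dGerm x)) (by
    rintro _ ⟨i, rfl⟩ _ ⟨j, rfl⟩
    exact dGerm_comm i j)
  letI : CommRing (Subring.closure (Set.range (dGerm x))) :=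
    { (inferInstance : Ring (Subring.closure (Set.range (dGerm x)))) with
      mul_comm := mul_comm' }
  (Subring.subtype _).comp (MvPolynomial.eval₂Hom (Int.castRingHom _)
    (fun i => (⟨dGerm x i, Subring.subset_closure ⟨i, rfl⟩⟩ :
      Subring.closure (Set.range (dGerm x)))))

lemma dPoly_X (i : Fin k) : dPoly x (MvPolynomial.X i) = dGerm x i := by
  simp [dPoly]

/-- The operator `∂^α`. -/
def dMon (x : Fin k → ℂ) (α : Fin k →₀ ℕ) : DGerm x := dPoly x (MvPolynomial.monomial α 1)

lemma dMon_zero : dMon x 0 = 1 := map_one (dPoly x)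

lemma dMon_add (α β : Fin k →₀ ℕ) : dMon x (α + β) = dMon x α * dMon x β := by
  rw [dMon, dMon, dMon, ← map_mul, MvPolynomial.monomial_mul, one_mul]

lemma dMon_single (i : Fin k) : dMon x (Finsupp.single i 1) = dGerm x i := dPoly_X i

/-- The operator with a given total symbol: `f ζ^α` is sent to `f ∂^α`. -/
def ofSymbol (x : Fin k → ℂ) : MvPolynomial (Fin k) (HolGerm x) →ₗ[HolGerm x] DGerm x :=
  (MvPolynomial.basisMonomials (Fin k) (HolGerm x)).constr ℕ (dMon x)

lemma ofSymbol_monomial (α : Fin k →₀ ℕ) (f : HolGerm x) :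
    ofSymbol x (MvPolynomial.monomial α f) = mulHom x f * dMon x α := by
  have h : MvPolynomial.monomial α f = f • MvPolynomial.basisMonomials (Fin k) (HolGerm x) α := by
    rw [MvPolynomial.coe_basisMonomials, MvPolynomial.smul_monomial, smul_eq_mul, mul_one]
  rw [h, map_smul, ofSymbol, Module.Basis.constr_basis, smul_eq_mulHom]

lemma ofSymbol_one : ofSymbol x 1 = 1 := by
  refine (ofSymbol_monomial 0 1).trans ?_
  rw [dMon_zero, map_one, one_mul]

lemma ofSymbol_C_mul (f : HolGerm x) (r : MvPolynomial (Fin k) (HolGerm x)) :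
    ofSymbol x (MvPolynomial.C f * r) = mulHom x f * ofSymbol x r := by
  rw [← MvPolynomial.smul_eq_C_mul, map_smul, smul_eq_mulHom]

/-- Coefficients stand to the left of the `∂^α`, so a `∂_i` on the right needs no commutation. -/
lemma ofSymbol_mul_X (i : Fin k) (r : MvPolynomial (Fin k) (HolGerm x)) :
    ofSymbol x (r * MvPolynomial.X i) = ofSymbol x r * dGerm x i := by
  induction r using MvPolynomial.induction_on' with
  | monomial α f =>
    rw [MvPolynomial.X, MvPolynomial.monomial_mul, ofSymbol_monomial, ofSymbol_monomial, dMon_add,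
      dMon_single, mul_one, mul_assoc]
  | add p q hp hq => rw [add_mul, map_add, map_add, add_mul, hp, hq]

lemma ofSymbol_C (f : HolGerm x) : ofSymbol x (MvPolynomial.C f) = mulHom x f := by
  rw [← mul_one (MvPolynomial.C f), ofSymbol_C_mul, ofSymbol_one, mul_one]

/-- The germ at `x` of the coordinate `σ_h`, `h = i + 1`. -/
def coordGerm (x : Fin k → ℂ) (i : Fin k) : HolGerm x :=
  HolGerm.of (fun y => y i)
    ((ContinuousLinearMap.proj (R := ℂ) (φ := fun _ : Fin k => ℂ) i).analyticAt x)

lemma dGerm_mul_coordGerm (i j : Fin k) :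
    dGerm x i * mulHom x (coordGerm x j) =
      mulHom x (coordGerm x j) * dGerm x i + if i = j then 1 else 0 := by
  have h := congrArg (fun P : GlobalOp k => P.germ x) (GlobalOp.d_mul_σ i j)
  split_ifs at h ⊢ <;> exact h

/-- The commutator with `σ_i` differentiates the symbol in `ζ_i`. This is what turns right
multiplication by `E` and `U_0` into first-order operators on symbols. -/
lemma ofSymbol_mul_coordGerm (i : Fin k) (r : MvPolynomial (Fin k) (HolGerm x)) :
    ofSymbol x r * mulHom x (coordGerm x i) =
      ofSymbol x (MvPolynomial.C (coordGerm x i) * r + MvPolynomial.pderiv i r) := by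
  induction r using MvPolynomial.induction_on with
  | C a =>
    rw [MvPolynomial.pderiv_C, add_zero, ofSymbol_C_mul, ofSymbol_C, ← map_mul, ← map_mul, mul_comm]
  | add p q hp hq =>
    rw [map_add, add_mul, hp, hq, ← map_add, map_add (MvPolynomial.pderiv i)]
    congr 1
    ring
  | mul_X p j hp =>
    rw [ofSymbol_mul_X, mul_assoc, dGerm_mul_coordGerm, mul_add, ← mul_assoc, hp, ← ofSymbol_mul_X]
    by_cases h : j = i
    · subst h
      rw [if_pos rfl, mul_one, ← map_add]
      congr 1
      rw [Derivation.leibniz, MvPolynomial.pderiv_X_self]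
      simp only [smul_eq_mul]
      ring
    · rw [if_neg h, mul_zero, add_zero]
      congr 1
      rw [Derivation.leibniz, MvPolynomial.pderiv_X_of_ne h]
      simp only [smul_eq_mul]
      ring

lemma dGerm_apply_one (i : Fin k) : (dGerm x i).1 1 = 0 := by
  exact (partialDer x i).map_one_eq_zero

lemma dMon_apply_one {α : Fin k →₀ ℕ} (hα : α ≠ 0) : (dMon x α).1 1 = 0 := by
  obtain ⟨i, hi⟩ := Finsupp.ne_iff.1 hα
  have h : α = (α - Finsupp.single i 1) + Finsupp.single i 1 :=
    (tsub_add_cancel_of_le (Finsupp.single_le_iff.2 (Nat.one_le_iff_ne_zero.2 hi))).symm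
  rw [h, dMon_add, dMon_single]
  change (dMon x _).1 ((dGerm x i).1 1) = 0
  rw [dGerm_apply_one, map_zero]

/-- Every `∂^α` with `α ≠ 0` kills the function `1`, so evaluation there isolates the term of order
zero. -/
lemma ofSymbol_apply_one (r : MvPolynomial (Fin k) (HolGerm x)) :
    (ofSymbol x r).1 1 = r.coeff 0 := by
  induction r using MvPolynomial.induction_on' with
  | monomial α f =>
    rw [ofSymbol_monomial, MvPolynomial.coeff_monomial]
    change f * ((dMon x α).1 1) = _
    split_ifs with h
    · subst h
      rw [dMon_zero]
      exact mul_one f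
    · rw [dMon_apply_one h, mul_zero]
  | add p q hp hq => 
    rw [map_add, MvPolynomial.coeff_add, ← hp, ← hq]
    rfl

lemma HolGerm.natCast_mul_eq_zero {n : ℕ} (hn : n ≠ 0) {f : HolGerm x} (h : (n : HolGerm x) * f = 0) :
    f = 0 := by
  have hc : AnalyticAt ℂ (fun _ : Fin k → ℂ => ((n : ℂ)⁻¹)) x := analyticAt_const
  have h1 : HolGerm.of _ hc * (n : HolGerm x) = 1 := by
    have : ((n : HolGerm x)) = HolGerm.of (fun _ => (n : ℂ)) analyticAt_const := by
      refine Subtype.ext ?_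
      rw [SubringClass.coe_natCast]
      rfl
    rw [this]
    refine Subtype.ext (Germ.coe_eq.2 (Eventually.of_forall fun y => ?_))
    exact inv_mul_cancel₀ (Nat.cast_ne_zero.2 hn)
  rw [← one_mul f, ← h1, mul_assoc, h, mul_zero]

/-- Commutators with the `σ_i` bring any coefficient, up to a nonzero integer factor, into order
zero, where it is read off on the function `1`. -/
lemma ofSymbol_eq_zero {r : MvPolynomial (Fin k) (HolGerm x)} (h : ofSymbol x r = 0) : r = 0 := by
  suffices H : ∀ n : ℕ, ∀ r : MvPolynomial (Fin k) (HolGerm x), ofSymbol x r = 0 →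
      ∀ α : Fin k →₀ ℕ, α.degree = n → r.coeff α = 0 from
    MvPolynomial.ext _ _ fun α => H _ r h α rfl
  -- The symbol `r` stays quantified, because the inductive step replaces it by `∂r/∂ζ_i`.
  intro n
  induction n with
  | zero =>
    intro r hr α hα
    rw [(Finsupp.degree_eq_zero_iff α).1 hα, ← ofSymbol_apply_one, hr]
    rfl
  | succ n ih =>
    intro r hr α hα
    have h0 : α ≠ 0 := by
      rintro rfl
      simp at hα
    obtain ⟨i, hi⟩ := Finsupp.ne_iff.1 h0
    have e : α = (α - Finsupp.single i 1) + Finsupp.single i 1 :=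
      (tsub_add_cancel_of_le (Finsupp.single_le_iff.2 (Nat.one_le_iff_ne_zero.2 hi))).symm
    have h1 : ofSymbol x (MvPolynomial.pderiv i r) = 0 := by
      have := ofSymbol_mul_coordGerm i r
      rwa [map_add, ofSymbol_C_mul, hr, zero_mul, mul_zero, zero_add, eq_comm] at this
    have h2 := ih _ h1 (α - Finsupp.single i 1) (by
      rw [e, map_add, Finsupp.degree_single] at hα
      omega)
    rw [MvPolynomial.coeff_pderiv, ← e] at h2
    refine HolGerm.natCast_mul_eq_zero (n := (α - Finsupp.single i 1 : Fin k →₀ ℕ) i + 1) (by omega) ?_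
    rw [mul_comm]
    push_cast
    exact h2

lemma ofSymbol_injective : Function.Injective (ofSymbol x) :=
  (injective_iff_map_eq_zero _).2 fun _ h => ofSymbol_eq_zero h

end Symbol

/-! ### Total symbols of sections -/

/-- The ring of functions that are holomorphic on `U`. -/
def holRing (U : Opens (N k)) : Subring ((Fin k → ℂ) → ℂ) where
  carrier := {f | AnalyticOnNhd ℂ f (U : Set (Fin k → ℂ))}
  mul_mem' hf hg := hf.mul hg
  one_mem' := analyticOnNhd_const
  add_mem' hf hg := hf.add hg
  zero_mem' := analyticOnNhd_const
  neg_mem' hf := hf.neg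

/-- The germ at a point of `U` of a function that is holomorphic on `U`. -/
def toGerm {U : Opens (N k)} (x : U) : holRing U →+* HolGerm x.1 where
  toFun f := HolGerm.of f.1 (f.2 x.1 x.2)
  map_one' := rfl
  map_mul' _ _ := rfl
  map_zero' := rfl
  map_add' _ _ := rfl

/-- The family of germs of operators with a given total symbol. -/
def famOfSymbol {U : Opens (N k)} (r : MvPolynomial (Fin k) (holRing U)) (x : U) : DGerm x.1 :=
  ofSymbol x.1 (r.map (toGerm x))

lemma famOfSymbol_add {U : Opens (N k)} (r s : MvPolynomial (Fin k) (holRing U)) :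
    famOfSymbol (r + s) = famOfSymbol r + famOfSymbol s := by
  funext x
  simp [famOfSymbol]

lemma exists_partialFam_mul {U : Opens (N k)} (i : Fin k) (r : MvPolynomial (Fin k) (holRing U)) :
    ∃ s, partialFam U i * famOfSymbol r = famOfSymbol s := by
  induction r using MvPolynomial.induction_on' with
  | monomial α f =>
    refine ⟨MvPolynomial.monomial α f * MvPolynomial.X i + MvPolynomial.monomial α
      (⟨partialFun i f.1, fun y hy => partialFun_analyticAt i (f.2 y hy)⟩ : holRing U), ?_⟩
    funext x
    rw [famOfSymbol_add]
    change dGerm x.1 i * famOfSymbol _ x = famOfSymbol _ x + famOfSymbol _ x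
    simp only [famOfSymbol, MvPolynomial.map_monomial, map_mul, MvPolynomial.map_X, ofSymbol_mul_X]
    simp only [ofSymbol_monomial]
    rw [← mul_assoc, dGerm_mul_mulHom, add_mul, mul_assoc, mul_assoc, ← dMon_single, ← dMon_add,
      ← dMon_add, add_comm α]
    rfl
  | add p q hp hq =>
    obtain ⟨s, hs⟩ := hp
    obtain ⟨t, ht⟩ := hq
    exact ⟨s + t, by rw [famOfSymbol_add, famOfSymbol_add, mul_add, hs, ht]⟩

/-- The quantifier over all `r` lets the closure induction pass through products; `r = 1` then
yields a symbol for `P` itself. -/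
lemma exists_mul_famOfSymbol {U : Opens (N k)} {P : ∀ x : U, DGerm x.1}
    (hP : P ∈ finiteOrderOps U) :
    ∀ r : MvPolynomial (Fin k) (holRing U), ∃ s, P * famOfSymbol r = famOfSymbol s := by
  induction hP using Subring.closure_induction with
  | mem P hP =>
    intro r
    rcases hP with ⟨f, hf, rfl⟩ | ⟨i, rfl⟩
    · refine ⟨MvPolynomial.C ⟨f, hf⟩ * r, ?_⟩
      funext x
      change mulHom x.1 (toGerm x ⟨f, hf⟩) * _ = _
      simp [famOfSymbol, ofSymbol_C_mul]
    · exact exists_partialFam_mul i r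
  | zero => exact fun r => ⟨0, by funext x; simp [famOfSymbol]⟩
  | one => exact fun r => ⟨r, one_mul _⟩
  | add P Q _ _ hP hQ =>
    intro r
    obtain ⟨s, hs⟩ := hP r
    obtain ⟨t, ht⟩ := hQ r
    exact ⟨s + t, by rw [famOfSymbol_add, add_mul, hs, ht]⟩
  | neg P _ hP =>
    intro r
    obtain ⟨s, hs⟩ := hP r
    refine ⟨-s, ?_⟩
    rw [neg_mul, hs]
    funext x
    simp [famOfSymbol]
  | mul P Q _ _ hP hQ =>
    intro r
    obtain ⟨s, hs⟩ := hQ r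
    obtain ⟨t, ht⟩ := hP s
    exact ⟨t, by rw [mul_assoc, hs, ht]⟩

lemma exists_symbol {U : Opens (N k)} {P : ∀ x : U, DGerm x.1} (hP : P ∈ finiteOrderOps U) :
    ∃ r : MvPolynomial (Fin k) (holRing U), P = famOfSymbol r := by
  obtain ⟨s, hs⟩ := exists_mul_famOfSymbol hP 1
  refine ⟨s, hs ▸ ?_⟩
  funext x
  change P x = P x * famOfSymbol 1 x
  simp [famOfSymbol, ofSymbol_one]

/-- Every germ of operator extends to a section near the point. -/
lemma exists_section (x : Fin k → ℂ) (P : DGerm x) :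
    ∃ (U : Opens (N k)) (hx : x ∈ U), ∃ s ∈ finiteOrderOps U, s ⟨x, hx⟩ = P := by
  obtain ⟨P, hP⟩ := P
  induction hP using Subring.closure_induction with
  | mem P hP =>
    rcases hP with ⟨a, rfl⟩ | ⟨i, rfl⟩
    · obtain ⟨f, hf, rfl⟩ := HolGerm.exists_rep a
      obtain ⟨V, hV, hVo, hxV⟩ := eventually_nhds_iff.1 hf.eventually_analyticAt
      exact ⟨⟨V, hVo⟩, hxV, mulFam ⟨V, hVo⟩ f hV, Subring.subset_closure (Or.inl ⟨f, hV, rfl⟩), rfl⟩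
    · exact ⟨⊤, trivial, partialFam ⊤ i, Subring.subset_closure (Or.inr ⟨i, rfl⟩), rfl⟩
  | zero => exact ⟨⊤, trivial, 0, zero_mem _, rfl⟩
  | one => exact ⟨⊤, trivial, 1, one_mem _, rfl⟩
  | add P Q _ _ hP hQ =>
    obtain ⟨U, hU, s, hs, e⟩ := hP
    obtain ⟨V, hV, t, ht, e'⟩ := hQ
    refine ⟨U ⊓ V, ⟨hU, hV⟩, restrictFam (Opens.infLELeft U V) s +
      restrictFam (Opens.infLERight U V) t, add_mem (restrictFam_mem _ hs) (restrictFam_mem _ ht), ?_⟩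
    change s ⟨x, hU⟩ + t ⟨x, hV⟩ = _
    rw [e, e']
    rfl
  | neg P _ hP =>
    obtain ⟨U, hU, s, hs, e⟩ := hP
    refine ⟨U, hU, -s, neg_mem hs, ?_⟩
    change -(s ⟨x, hU⟩) = _
    rw [e]
    rfl
  | mul P Q _ _ hP hQ =>
    obtain ⟨U, hU, s, hs, e⟩ := hP
    obtain ⟨V, hV, t, ht, e'⟩ := hQ
    refine ⟨U ⊓ V, ⟨hU, hV⟩, restrictFam (Opens.infLELeft U V) s *
      restrictFam (Opens.infLERight U V) t, mul_mem (restrictFam_mem _ hs) (restrictFam_mem _ ht), ?_⟩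
    change s ⟨x, hU⟩ * t ⟨x, hV⟩ = _
    rw [e, e']
    rfl

lemma ofSymbol_surjective (x : Fin k → ℂ) : Function.Surjective (ofSymbol x) := by
  intro P
  obtain ⟨U, hx, s, hs, rfl⟩ := exists_section x P
  obtain ⟨r, rfl⟩ := exists_symbol hs
  exact ⟨_, rfl⟩

/-- An operator of finite order whose germ at a point vanishes is zero near that point. -/
lemma eventually_eq_zero_of_mem_finiteOrderOps {U : Opens (N k)} {s : ∀ x : U, DGerm x.1}
    (hs : s ∈ finiteOrderOps U) {x : U} (h : s x = 0) :
    ∃ V : Opens (N k), x.1 ∈ V ∧ ∃ i : V ≤ U, ∀ y : V, s ⟨y.1, i y.2⟩ = 0 := by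
  obtain ⟨r, rfl⟩ := exists_symbol hs
  have hr := ofSymbol_eq_zero h
  have h1 : ∀ α ∈ r.support, ∀ᶠ y in 𝓝 x.1, (r.coeff α).1 y = 0 := by
    intro α _
    have := congrArg (MvPolynomial.coeff α) hr
    rw [MvPolynomial.coeff_map] at this
    exact Germ.coe_eq.1 (congrArg Subtype.val this)
  -- A symbol has finitely many coefficients, so one neighbourhood serves for all of them.
  have h2 := (Filter.eventually_all_finset r.support).2 h1
  obtain ⟨V, hV, hVo, hxV⟩ := eventually_nhds_iff.1 h2
  refine ⟨⟨V, hVo⟩ ⊓ U, ⟨hxV, x.2⟩, inf_le_right, fun y => ?_⟩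
  have : r.map (toGerm ⟨y.1, y.2.2⟩) = 0 := by
    ext1 α
    rw [MvPolynomial.coeff_map, MvPolynomial.coeff_zero]
    by_cases hα : α ∈ r.support
    · refine Subtype.ext (Germ.coe_eq.2 ?_)
      filter_upwards [hVo.mem_nhds y.2.1] with z hz
      exact hV z hz α hα
    · rw [MvPolynomial.notMem_support_iff.1 hα, map_zero]
  change ofSymbol y.1 (r.map (toGerm ⟨y.1, y.2.2⟩)) = 0
  rw [this, map_zero]

/-! ### The graded model of `M_μ` -/

section Model

open Polynomial

variable {O : Type*} [CommRing O]

/-- The operator `t ∂_t` on `O[t][c]`. -/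
def thetaT (O : Type*) [CommRing O] : Derivation O O[X][X] O[X][X] :=
  PolynomialModule.equivPolynomialSelf.toLinearMap.compDer
    ((X : O[X]) • (derivative' : Derivation O O[X] O[X])).mapCoeffs

lemma coeff_thetaT (v : O[X][X]) (n : ℕ) : (thetaT O v).coeff n = X * derivative (v.coeff n) :=
  rfl

lemma thetaT_derivative (v : O[X][X]) : thetaT O (derivative v) = derivative (thetaT O v) := by
  ext1 n
  simp only [coeff_thetaT, coeff_derivative]
  rw [derivative_mul]
  simp
  ring

/-- The relation operator `c Q + c ∂_c + μ`. -/
def relOp (Q : O[X]) (μ : O) (w : O[X][X]) : O[X][X] :=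
  X * C Q * w + X * derivative w + C (C μ) * w

/-- The operator `c t Q' + t ∂_t - λ`, which models right multiplication by `U_0 - λ`. -/
def eulerOp (Q : O[X]) (lam : O) (v : O[X][X]) : O[X][X] :=
  X * C (X * derivative Q) * v + thetaT O v - C (C lam) * v

lemma relOp_add (Q : O[X]) (μ : O) (v w : O[X][X]) :
    relOp Q μ (v + w) = relOp Q μ v + relOp Q μ w := by
  simp only [relOp, map_add]
  ring

lemma relOp_zero (Q : O[X]) (μ : O) : relOp Q μ 0 = 0 := by simp [relOp]

lemma relOp_sub (Q : O[X]) (μ : O) (v w : O[X][X]) :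
    relOp Q μ (v - w) = relOp Q μ v - relOp Q μ w := by
  simp only [relOp, map_sub]
  ring

lemma eulerOp_sub (Q : O[X]) (lam : O) (v w : O[X][X]) :
    eulerOp Q lam (v - w) = eulerOp Q lam v - eulerOp Q lam w := by
  simp only [eulerOp, map_sub]
  ring

/-- The commutator of `c Q` with `t ∂_t` is `-c t Q'`, that of `c ∂_c` with `c t Q'` is `c t Q'`,
and they cancel. -/
lemma eulerOp_relOp (Q : O[X]) (μ lam : O) (w : O[X][X]) :
    eulerOp Q lam (relOp Q μ w) = relOp Q μ (eulerOp Q lam w) := by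
  have h1 : thetaT O X = 0 := by ext1 n; simp [coeff_thetaT, coeff_X, apply_ite]
  have h2 : ∀ f : O[X], thetaT O (C f) = C (X * derivative f) := by
    intro f; ext1 n; rw [coeff_thetaT, coeff_C, coeff_C]; split_ifs <;> simp
  simp only [relOp, eulerOp, map_add, map_sub, Derivation.leibniz, derivative_mul, derivative_X, derivative_C, h1, h2, thetaT_derivative, smul_eq_mul, map_zero, mul_zero, map_mul]
  ring

/-- The monomials `c^q t^s` of `v` satisfy `q + a ≤ s ≤ k q`. -/
def SuppBound (k a : ℕ) (v : O[X][X]) : Prop :=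
  ∀ q s, (v.coeff q).coeff s ≠ 0 → q + a ≤ s ∧ s ≤ k * q

namespace SuppBound

variable {k a b : ℕ} {v w : O[X][X]}

lemma zero : SuppBound k a (0 : O[X][X]) := fun q s h => absurd (by simp) h

lemma add (hv : SuppBound k a v) (hw : SuppBound k a w) : SuppBound k a (v + w) := by
  intro q s h
  by_cases h1 : (v.coeff q).coeff s = 0
  · refine hw q s fun h2 => h ?_
    rw [coeff_add, coeff_add, h1, h2, add_zero]
  · exact hv q s h1

lemma neg (hv : SuppBound k a v) : SuppBound k a (-v) := by
  intro q s h
  refine hv q s fun h2 => h ?_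
  rw [coeff_neg, coeff_neg, h2, neg_zero]

lemma sub (hv : SuppBound k a v) (hw : SuppBound k a w) : SuppBound k a (v - w) := by
  rw [sub_eq_add_neg]
  exact hv.add hw.neg

lemma mono (hv : SuppBound k a v) (h : b ≤ a) : SuppBound k b v := fun q s hs => by
  have := hv q s hs
  omega

lemma C_C_mul (hv : SuppBound k a v) (m : O) : SuppBound k a (C (C m) * v) := by
  intro q s h
  refine hv q s fun h2 => h ?_
  rw [coeff_C_mul, coeff_C_mul, h2, mul_zero]

lemma X_mul_derivative (hv : SuppBound k a v) : SuppBound k a (X * derivative v) := by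
  intro q s h
  refine hv q s fun h2 => h ?_
  cases q with
  | zero => simp
  | succ q =>
    rw [coeff_X_mul, coeff_derivative, ← Nat.cast_succ, ← C_eq_natCast, coeff_mul_C, h2, zero_mul]

lemma thetaT (hv : SuppBound k a v) : SuppBound k a (thetaT O v) := by
  intro q s h
  refine hv q s fun h2 => h ?_
  rw [coeff_thetaT]
  cases s with
  | zero => simp
  | succ s => rw [coeff_X_mul, coeff_derivative, h2, zero_mul]

/-- The factor `c` raises the lower bound by one; the hypothesis on `g` says how much of this its
powers of `t` make up for. -/
lemma X_mul_C_mul (hv : SuppBound k a v) {g : O[X]}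
    (hg : ∀ s, g.coeff s ≠ 0 → b + 1 ≤ s + a ∧ s ≤ k) : SuppBound k b (X * C g * v) := by
  intro q s h
  cases q with
  | zero => simp [mul_assoc] at h
  | succ q =>
    rw [mul_assoc, coeff_X_mul, coeff_C_mul, coeff_mul] at h
    obtain ⟨⟨i, j⟩, hij, h1⟩ := Finset.exists_ne_zero_of_sum_ne_zero h
    have h2 := hg i (left_ne_zero_of_mul h1)
    have h3 := hv q j (right_ne_zero_of_mul h1)
    rw [Finset.HasAntidiagonal.mem_antidiagonal] at hij
    simp only at hij
    rw [Nat.mul_succ]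
    omega

/-- The constant term of `Q` raises the power of `c` but not that of `t`, which costs one in the
lower bound. -/
lemma relOp {Q : O[X]} (hQ : Q.natDegree ≤ k) (μ : O) (hv : SuppBound k 1 v) :
    SuppBound k 0 (relOp Q μ v) := by
  refine ((hv.X_mul_C_mul fun s hs => ?_).add (hv.X_mul_derivative.mono zero_le_one)).add
    ((hv.C_C_mul μ).mono zero_le_one)
  exact ⟨by omega, (le_natDegree_of_ne_zero hs).trans hQ⟩

/-- Unlike `Q`, the polynomial `t Q'` has no constant term, so nothing is lost in the lower bound.
-/
lemma eulerOp {Q : O[X]} (hQ : Q.natDegree ≤ k) (lam : O) (hv : SuppBound k a v) :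
    SuppBound k a (eulerOp Q lam v) := by
  refine ((hv.X_mul_C_mul fun s hs => ?_).add hv.thetaT).sub (hv.C_C_mul lam)
  cases s with
  | zero => simp at hs
  | succ s =>
    rw [coeff_X_mul, coeff_derivative] at hs
    exact ⟨by omega, (le_natDegree_of_ne_zero (left_ne_zero_of_mul hs)).trans hQ⟩

end SuppBound

lemma coeff_succ_relOp (Q : O[X]) (μ : O) (w : O[X][X]) (n : ℕ) :
    (relOp Q μ w).coeff (n + 1) = Q * w.coeff n + ((n + 1 : ℕ) + C μ) * w.coeff (n + 1) := by
  simp only [relOp, coeff_add, mul_assoc, coeff_X_mul, coeff_C_mul, coeff_derivative]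
  push_cast
  ring

lemma coeff_succ_eulerOp (Q : O[X]) (lam : O) (v : O[X][X]) (n : ℕ) :
    (eulerOp Q lam v).coeff (n + 1) = X * derivative Q * v.coeff n +
      (X * derivative (v.coeff (n + 1)) - C lam * v.coeff (n + 1)) := by
  simp only [eulerOp, coeff_sub, coeff_add, mul_assoc, coeff_X_mul, coeff_C_mul, coeff_thetaT]
  ring

lemma isCoprime_X_of_coeff_zero {Q : O[X]} (hQ : Q.coeff 0 = 1) : IsCoprime X Q := by
  refine ⟨-Q.divX, 1, ?_⟩
  have := Q.divX_mul_X_add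
  rw [hQ, map_one] at this
  linear_combination -this

variable [IsDomain O]

/-- If `eulerOp v` is a relation, then so is `v`. -/
theorem exists_relOp_of_eulerOp {k : ℕ} (hk : 1 ≤ k) {Q : O[X]} (hQ0 : Q.coeff 0 = 1)
    (hQk : Q.natDegree = k) (hQ : ∀ v, Q ∣ X * derivative Q * v → Q ∣ v) (μ lam : O)
    {v w : O[X][X]} (hv : SuppBound k 0 v) (hw : SuppBound k 1 w)
    (h : eulerOp Q lam v = relOp Q μ w) : ∃ w', SuppBound k 1 w' ∧ v = relOp Q μ w' := by
  have hQne : Q ≠ 0 := fun h0 => by simp [h0] at hQ0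
  -- Induction on a strict bound for the degree of `v` in `c`; `w` varies because it is corrected
  -- along with `v`.
  suffices H : ∀ n, ∀ v w : O[X][X], SuppBound k 0 v → SuppBound k 1 w →
      (∀ q, n ≤ q → v.coeff q = 0) → eulerOp Q lam v = relOp Q μ w →
      ∃ w', SuppBound k 1 w' ∧ v = relOp Q μ w' from
    H (v.natDegree + 1) v w hv hw
      (fun q hq => coeff_eq_zero_of_natDegree_lt (Nat.lt_of_succ_le hq)) h
  clear h hv hw v w
  intro n
  induction n with
  | zero =>
    intro v w _ _ h0 _
    refine ⟨0, .zero, ?_⟩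
    rw [relOp_zero]
    ext1 q
    exact h0 q (Nat.zero_le q)
  | succ p ih =>
    intro v w hv hw h0 h
    -- If `w` had larger degree `n`, the coefficient of `c^(n+1)` would give `Q w_n = 0`.
    have hdeg : w.natDegree ≤ p := by
      by_contra! hlt
      have h1 := congrArg (fun u : O[X][X] => u.coeff (w.natDegree + 1)) h
      simp only [coeff_succ_relOp, coeff_succ_eulerOp] at h1
      rw [h0 _ (by omega), h0 _ (by omega), coeff_eq_zero_of_natDegree_lt (Nat.lt_succ_self _)] at h1
      simp only [mul_zero, map_zero, sub_zero, add_zero] at h1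
      rcases mul_eq_zero.1 h1.symm with h2 | h2
      · exact hQne h2
      · rw [coeff_natDegree, leadingCoeff_eq_zero] at h2
        simp [h2] at hlt
    -- The coefficient of `c^(p+1)` reads `t Q' v_p = Q w_p`.
    have h1 := congrArg (fun u : O[X][X] => u.coeff (p + 1)) h
    simp only [coeff_succ_relOp, coeff_succ_eulerOp] at h1
    rw [h0 _ le_rfl, coeff_eq_zero_of_natDegree_lt (Nat.lt_succ_of_le hdeg)] at h1
    simp only [mul_zero, map_zero, sub_zero, add_zero] at h1
    obtain ⟨b, hb⟩ := hQ _ (Dvd.intro _ h1.symm)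
    -- the bounds on the support of `b`
    have hlow : ∀ s, s < p → b.coeff s = 0 := by
      -- The power `t^p` divides `v_p = Q b` and is coprime to `Q`, since `Q(0) = 1`.
      have : (X : O[X]) ^ p ∣ Q * b := by
        rw [← hb, X_pow_dvd_iff]
        intro d hd
        by_contra hne
        have := hv p d hne
        omega
      exact X_pow_dvd_iff.1 ((isCoprime_X_of_coeff_zero hQ0).pow_left.dvd_of_dvd_mul_left this)
    have hup : ∀ s, b.coeff s ≠ 0 → s + k ≤ k * p := by
      intro s hs
      have hb0 : b ≠ 0 := fun h => by simp [h] at hs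
      have h2 : (v.coeff p).natDegree ≤ k * p := by
        refine natDegree_le_iff_coeff_eq_zero.2 fun m hm => ?_
        by_contra hne
        have := hv p m hne
        omega
      rw [hb, natDegree_mul hQne hb0, hQk] at h2
      have := le_natDegree_of_ne_zero hs
      omega
    -- The witness is `u = c^(p-1) b`: its relation has leading term `c^p Q b`, and the bounds on
    -- `b` are exactly those of `SuppBound k 1` at exponent `p - 1`. For `p = 0` the upper bound
    -- forces `b = 0`.
    have hcase : ∃ u : O[X][X], SuppBound k 1 u ∧ (relOp Q μ u).coeff p = v.coeff p ∧
        ∀ q, p < q → (relOp Q μ u).coeff q = 0 := by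
      cases p with
      | zero =>
        have hb0 : b = 0 := by
          ext s
          by_contra hs
          have := hup s hs
          omega
        refine ⟨0, .zero, ?_, ?_⟩
        · rw [relOp_zero, hb, hb0, mul_zero, coeff_zero]
        · intro q _
          rw [relOp_zero, coeff_zero]
      | succ p =>
        refine ⟨monomial p b, ?_, ?_, ?_⟩
        · intro q s hs
          rw [coeff_monomial] at hs
          split_ifs at hs with hq
          · subst hq
            have h3 := hup s hs
            rw [Nat.mul_succ] at h3
            refine ⟨?_, by omega⟩
            by_contra! hlt
            exact hs (hlow s hlt)
          · simp at hs
        · rw [coeff_succ_relOp, coeff_monomial, coeff_monomial, if_pos rfl, if_neg (by omega),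
            mul_zero, add_zero, hb]
        · rintro (_ | q) hq
          · omega
          · rw [coeff_succ_relOp, coeff_monomial, coeff_monomial, if_neg (by omega),
              if_neg (by omega), mul_zero, mul_zero, add_zero]
    obtain ⟨u, hu, hup, huq⟩ := hcase
    -- Since the two operators commute, correcting `w` by `eulerOp u` preserves the equation.
    obtain ⟨w', hw', e⟩ := ih (v - relOp Q μ u) (w - eulerOp Q lam u)
      (hv.sub (hu.relOp hQk.le μ)) (hw.sub (hu.eulerOp hQk.le lam)) (by
        intro q hq
        rw [coeff_sub]
        rcases hq.eq_or_lt with rfl | hq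
        · rw [hup, sub_self]
        · rw [huq q hq, h0 q hq, sub_zero]) (by
        rw [eulerOp_sub, relOp_sub, h, eulerOp_relOp])
    exact ⟨w' + u, hw'.add hu, by rw [relOp_add, ← e, sub_add_cancel]⟩

/-- If `δ v = Q w`, comparing coefficients is a triangular system with diagonal `Q(0) = 1`; hence
`δ` divides every coefficient of `w`, and it cancels. -/
lemma dvd_of_dvd_C_mul {Q : O[X]} (hQ0 : Q.coeff 0 = 1) {δ : O} (hδ : δ ≠ 0) {v : O[X]}
    (h : Q ∣ C δ * v) : Q ∣ v := by
  obtain ⟨w, hw⟩ := h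
  have h1 : C δ ∣ w := by
    rw [C_dvd_iff_dvd_coeff]
    intro n
    induction n using Nat.strong_induction_on with
    | _ n ih =>
      have h2 := congrArg (fun u : O[X] => u.coeff n) hw
      simp only [coeff_mul] at h2
      rw [← coeff_mul, coeff_C_mul] at h2
      rw [← Finset.add_sum_erase _ _ (Finset.HasAntidiagonal.mem_antidiagonal.2
        (show (0, n).1 + (0, n).2 = n from zero_add n)), hQ0, one_mul] at h2
      refine (dvd_add_left (Finset.dvd_sum ?_)).1 (h2 ▸ dvd_mul_right _ _)
      rintro ⟨i, j⟩ hij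
      simp only [Finset.mem_erase, Finset.HasAntidiagonal.mem_antidiagonal, ne_eq, Prod.mk.injEq, not_and] at hij
      exact (ih j (by omega)).mul_left _
  obtain ⟨b, rfl⟩ := h1
  exact ⟨b, mul_left_cancel₀ (C_ne_zero.2 hδ) (by rw [hw]; ring)⟩

end Model

/-! ### The generic polynomial `1 + ∑ σ_h t^h` over the ring of germs -/

section Germs

variable {x : Fin k → ℂ}

instance : Nontrivial (HolGerm x) :=
  ⟨0, 1, fun h => by
    have h1 : (fun _ : Fin k → ℂ => (0 : ℂ)) =ᶠ[𝓝 x] fun _ => 1 :=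
      Germ.coe_eq.1 (congrArg Subtype.val h)
    exact zero_ne_one h1.self_of_nhds⟩

lemma exists_ball_analyticOnNhd {f : (Fin k → ℂ) → ℂ} (hf : AnalyticAt ℂ f x) :
    ∀ᶠ r : ℝ in 𝓝[>] 0, AnalyticOnNhd ℂ f (Metric.ball x r) := by
  obtain ⟨ε, hε, h⟩ := Metric.eventually_nhds_iff_ball.1 hf.eventually_analyticAt
  filter_upwards [Ioo_mem_nhdsGT hε] with r hr y hy
  exact h y (Metric.ball_subset_ball hr.2.le hy)

instance : NoZeroDivisors (HolGerm x) where
  eq_zero_or_eq_zero_of_mul_eq_zero {a b} hab := by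
    obtain ⟨f, hf, rfl⟩ := HolGerm.exists_rep a
    obtain ⟨g, hg, rfl⟩ := HolGerm.exists_rep b
    have h : (fun y => f y * g y) =ᶠ[𝓝 x] fun _ => 0 := Germ.coe_eq.1 (congrArg Subtype.val hab)
    obtain ⟨ε, hε, h⟩ := Metric.eventually_nhds_iff_ball.1 h
    obtain ⟨r, ⟨hr0, hrε⟩, hr⟩ := ((eventually_mem_set.2 (Ioo_mem_nhdsGT hε)).and
      (exists_ball_analyticOnNhd hg)).exists
    -- Either `f` vanishes near `x`, or it is nonzero near some `y` in the ball; then `g` vanishes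
    -- near `y`, hence on the ball by the identity theorem.
    by_cases hz : ∀ y ∈ Metric.ball x r ∩ {y | AnalyticAt ℂ f y}, f y = 0
    · left
      refine Subtype.ext (Germ.coe_eq.2 ?_)
      filter_upwards [Metric.ball_mem_nhds x hr0, hf.eventually_analyticAt] with y hy hy'
      exact hz y ⟨hy, hy'⟩
    · right
      push Not at hz
      obtain ⟨y, ⟨hy, hfy⟩, hne⟩ := hz
      have hgy : g =ᶠ[𝓝 y] 0 := by
        filter_upwards [hfy.continuousAt.eventually_ne hne, Metric.isOpen_ball.mem_nhds hy] with z hz hz'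
        exact (mul_eq_zero.1 (h z (Metric.ball_subset_ball hrε.le hz'))).resolve_left hz
      have := hr.eqOn_zero_of_preconnected_of_eventuallyEq_zero
        (convex_ball x r).isPreconnected hy hgy
      refine Subtype.ext (Germ.coe_eq.2 ?_)
      filter_upwards [Metric.ball_mem_nhds x hr0] with z hz
      exact this hz

instance : IsDomain (HolGerm x) := NoZeroDivisors.to_isDomain _

/-- The germ at `x` of a constant. -/
def constGerm (x : Fin k → ℂ) : ℂ →+* HolGerm x where
  toFun c := HolGerm.of (fun _ => c) analyticAt_const
  map_one' := rfl
  map_mul' _ _ := rfl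
  map_zero' := rfl
  map_add' _ _ := rfl

/-- The germ at `x` of a polynomial function. -/
def polyGerm (x : Fin k → ℂ) : MvPolynomial (Fin k) ℂ →+* HolGerm x :=
  MvPolynomial.eval₂Hom (constGerm x) (coordGerm x)

lemma polyGerm_eq (p : MvPolynomial (Fin k) ℂ) :
    (polyGerm x p).1 = ((fun y => MvPolynomial.eval y p : (Fin k → ℂ) → ℂ) : Germ (𝓝 x) ℂ) := by
  induction p using MvPolynomial.induction_on with
  | C a => simp [polyGerm]; rfl
  | add p q hp hq =>
    rw [map_add, Subring.coe_add, hp, hq]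
    simp only [map_add]
    rfl
  | mul_X p i hp =>
    rw [map_mul, Subring.coe_mul, hp]
    simp only [map_mul, MvPolynomial.eval_X]
    have : polyGerm x (MvPolynomial.X i) = coordGerm x i := by simp [polyGerm]
    rw [this]
    rfl

/-- By the identity theorem. It carries the nonvanishing of the resultant from polynomials to germs
at any point. -/
lemma polyGerm_injective (x : Fin k → ℂ) : Function.Injective (polyGerm x) := by
  refine (injective_iff_map_eq_zero _).2 fun p hp => ?_
  have h1 : (fun y => MvPolynomial.eval y p : (Fin k → ℂ) → ℂ) =ᶠ[𝓝 x] 0 := by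
    refine Germ.coe_eq.1 ?_
    rw [← polyGerm_eq, hp]
    rfl
  have h2 : AnalyticOnNhd ℂ (fun y => MvPolynomial.eval y p : (Fin k → ℂ) → ℂ) Set.univ := by
    have := AnalyticOnNhd.eval_mvPolynomial (𝕜 := ℂ) p
    exact this
  have h3 := h2.eqOn_zero_of_preconnected_of_eventuallyEq_zero isPreconnected_univ
    (Set.mem_univ x) h1
  refine MvPolynomial.funext fun y => ?_
  rw [map_zero]
  exact h3 (Set.mem_univ y)

/-- The germ is nonzero even where the coordinate takes the value zero, so the generic polynomial
has degree exactly `k` at every point. -/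
lemma coordGerm_ne_zero (i : Fin k) : coordGerm x i ≠ 0 := by
  have : polyGerm x (MvPolynomial.X i) = coordGerm x i := by simp [polyGerm]
  rw [← this, Ne, map_eq_zero_iff _ (polyGerm_injective x)]
  exact MvPolynomial.X_ne_zero i

end Germs

section Generic

open Polynomial

/-- The polynomial `1 + ∑ a_h t^h`. -/
def rootPoly {O : Type*} [CommRing O] (a : Fin k → O) : O[X] :=
  1 + ∑ i : Fin k, C (a i) * X ^ (i.val + 1)

section

variable {O : Type*} [CommRing O] (a : Fin k → O)

lemma rootPoly_map {S : Type*} [CommRing S] (φ : O →+* S) :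
    (rootPoly a).map φ = rootPoly (fun i => φ (a i)) := by
  simp [rootPoly, Polynomial.map_sum]

lemma coeff_zero_rootPoly : (rootPoly a).coeff 0 = 1 := by
  simp [rootPoly]

lemma X_mul_derivative_rootPoly :
    X * derivative (rootPoly a) = ∑ i : Fin k, ((i.val + 1 : ℕ) : O[X]) * (C (a i) * X ^ (i.val + 1)) := by
  rw [rootPoly, map_add, derivative_one, zero_add, map_sum, Finset.mul_sum]
  refine Finset.sum_congr rfl fun i _ => ?_
  rw [derivative_C_mul_X_pow]
  push_cast
  simp only [map_mul, map_add, map_natCast, map_one]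
  ring

lemma natDegree_rootPoly_le : (rootPoly a).natDegree ≤ k := by
  refine natDegree_add_le_of_degree_le (by simp) (natDegree_sum_le_of_forall_le _ _ fun i _ => ?_)
  exact (natDegree_C_mul_X_pow_le _ _).trans i.2

lemma natDegree_rootPoly (hk : 1 ≤ k) (ha : ∀ i, a i ≠ 0) : (rootPoly a).natDegree = k := by
  refine le_antisymm (natDegree_rootPoly_le a) (le_natDegree_of_ne_zero ?_)
  have h : (rootPoly a).coeff k = a ⟨k - 1, by omega⟩ := by
    rw [rootPoly, coeff_add, coeff_one, if_neg (by omega), zero_add, finsetSum_coeff,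
      Finset.sum_eq_single ⟨k - 1, by omega⟩]
    · rw [coeff_C_mul_X_pow, if_pos (by simp only; omega)]
    · intro i _ hi
      rw [coeff_C_mul_X_pow, if_neg]
      intro h
      exact hi (Fin.ext (by simp only; omega))
    · exact fun h => absurd (Finset.mem_univ _) h
  rw [h]
  exact ha _

end

/-- The resultant of the generic polynomial `Q` and of `t Q'` does not vanish. -/
lemma resultant_rootPoly_ne_zero (hk : 1 ≤ k) :
    resultant (rootPoly (MvPolynomial.X : Fin k → MvPolynomial (Fin k) ℂ))
      (X * derivative (rootPoly MvPolynomial.X)) k k ≠ 0 := by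
  intro h0
  -- The specialization `σ_k = -1`, other coordinates zero, turns `Q` into `1 - t^k` and `t Q'` into
  -- `-k t^k`, which are coprime.
  let e : MvPolynomial (Fin k) ℂ →+* ℂ :=
    MvPolynomial.eval (fun i : Fin k => if i.val + 1 = k then -1 else 0)
  have h1 : (rootPoly (MvPolynomial.X : Fin k → MvPolynomial (Fin k) ℂ)).map e = 1 - X ^ k := by
    rw [rootPoly_map, rootPoly, Finset.sum_eq_single ⟨k - 1, by omega⟩]
    · have : k - 1 + 1 = k := by omega
      simp [e, this]
      ring
    · intro i _ hi
      have : i.val + 1 ≠ k := fun h => hi (Fin.ext (by simp only; omega))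
      simp [e, this]
    · exact fun h => absurd (Finset.mem_univ _) h
  have h2 : (X * derivative (rootPoly (MvPolynomial.X : Fin k → MvPolynomial (Fin k) ℂ))).map e =
      C (-(k : ℂ)) * X ^ k := by
    rw [Polynomial.map_mul, map_X, ← derivative_map, h1]
    obtain ⟨m, rfl⟩ : ∃ m, k = m + 1 := ⟨k - 1, by omega⟩
    simp
    ring
  have hkc : (-(k : ℂ)) ≠ 0 := neg_ne_zero.2 (Nat.cast_ne_zero.2 (by omega))
  have d1 : (1 - X ^ k : ℂ[X]).natDegree = k := by
    rw [← natDegree_neg, neg_sub]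
    exact natDegree_X_pow_sub_C (r := (1 : ℂ))
  have d2 : (C (-(k : ℂ)) * X ^ k).natDegree = k := natDegree_C_mul_X_pow k _ hkc
  have h3 := resultant_ne_zero (1 - X ^ k : ℂ[X]) (C (-(k : ℂ)) * X ^ k) ⟨1, C (-(k : ℂ))⁻¹, by
    rw [← mul_assoc, ← C_mul, inv_mul_cancel₀ hkc, C_1]
    ring⟩
  rw [d1, d2, ← h1, ← h2, resultant_map_map, h0, map_zero] at h3
  exact h3 rfl

/-- The resultant `δ` is a combination of `Q` and `t Q'`, so `Q` divides `δ v`; then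
`dvd_of_dvd_C_mul` removes `δ`. -/
lemma rootPoly_dvd_of_dvd_X_mul_derivative_mul (hk : 1 ≤ k) (x : Fin k → ℂ) (v : (HolGerm x)[X])
    (h : rootPoly (coordGerm x) ∣ X * derivative (rootPoly (coordGerm x)) * v) :
    rootPoly (coordGerm x) ∣ v := by
  have hmap : (rootPoly (MvPolynomial.X : Fin k → MvPolynomial (Fin k) ℂ)).map (polyGerm x) =
      rootPoly (coordGerm x) := by
    rw [rootPoly_map]
    congr 1
    funext i
    simp [polyGerm]
  have hd : (X * derivative (rootPoly
      (MvPolynomial.X : Fin k → MvPolynomial (Fin k) ℂ))).natDegree ≤ k := by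
    rw [X_mul_derivative_rootPoly]
    refine natDegree_sum_le_of_forall_le _ _ fun i _ => ?_
    rw [← C_eq_natCast]
    exact (natDegree_C_mul_le _ _).trans ((natDegree_C_mul_X_pow_le _ _).trans i.2)
  obtain ⟨p, q, -, -, hpq⟩ := exists_mul_add_mul_eq_C_resultant _ _
    (natDegree_rootPoly_le (MvPolynomial.X : Fin k → MvPolynomial (Fin k) ℂ)) hd
    (Or.inl (by omega))
  have h1 := congrArg (Polynomial.map (polyGerm x)) hpq
  rw [Polynomial.map_add, Polynomial.map_mul, Polynomial.map_mul, Polynomial.map_mul, map_X,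
    ← derivative_map, hmap, Polynomial.map_C] at h1
  refine dvd_of_dvd_C_mul (coeff_zero_rootPoly _) (δ := polyGerm x _)
    (fun h0 => resultant_rootPoly_ne_zero hk
      ((map_eq_zero_iff _ (polyGerm_injective x)).1 h0)) ?_
  rw [← h1, add_mul]
  refine dvd_add ⟨p.map (polyGerm x) * v, by ring⟩ ?_
  rw [mul_right_comm]
  exact h.mul_right _

end Generic

/-! ### The toric normal form -/

section Toric

variable {S : Type*} [CommRing S]

/-- The normal form of the monomials of degree `q` and weight `s` in the `z i`. -/
def toricForm (m : ℕ) (z : ℕ → S) : ℕ → ℕ → S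
  | 0, _ => 1
  | q + 1, s => if s ≤ m then z s * z 0 ^ q else z m * toricForm m z q (s - m)

/-- Straightening: as `z_i z_j` depends only on `i + j`, a product of two factors can be rewritten
with `z_0` if the sum is at most `m`, and with `z_m` otherwise. -/
lemma mul_toricForm {m : ℕ} {z : ℕ → S}
    (hz : ∀ i j i' j', i ≤ m → j ≤ m → i' ≤ m → j' ≤ m → i + j = i' + j' → z i * z j = z i' * z j')
    {i : ℕ} (hi : i ≤ m) (q s : ℕ) (hs : s ≤ q * m) :
    z i * toricForm m z q s = toricForm m z (q + 1) (s + i) := by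
  induction q generalizing s with
  | zero =>
    obtain rfl : s = 0 := by omega
    simp [toricForm, hi]
  | succ q ih =>
    rw [Nat.succ_mul] at hs
    rw [toricForm]
    split_ifs with h
    · rw [toricForm]
      split_ifs with h'
      · rw [← mul_assoc, hz i s (s + i) 0 hi h h' (Nat.zero_le _) (by omega), pow_succ]
        ring
      · rw [← mul_assoc, hz i s m (s + i - m) hi h le_rfl (by omega) (by omega), toricForm,
          if_pos (by omega)]
        ring
    · rw [toricForm, if_neg (by omega), ← mul_assoc, mul_comm (z i), mul_assoc,
        ih (s - m) (by omega)]
      congr 2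
      omega

/-- Iterating the exchange of one unit between two indices connects any two pairs with the same sum.
-/
lemma eq_of_add_eq {m : ℕ} {z : ℕ → S}
    (hz : ∀ i j, i + 1 ≤ m → j + 1 ≤ m → z i * z (j + 1) = z (i + 1) * z j)
    (i j i' j' : ℕ) (hi : i ≤ m) (hj : j ≤ m) (hi' : i' ≤ m) (hj' : j' ≤ m)
    (h : i + j = i' + j') : z i * z j = z i' * z j' := by
  have key : ∀ d i j, i + d ≤ m → j + d ≤ m → z i * z (j + d) = z (i + d) * z j := by
    intro d
    induction d with
    | zero => exact fun _ _ _ _ => rfl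
    | succ d ih =>
      intro i j hi hj
      rw [← add_assoc, hz i (j + d) (by omega) (by omega), ih (i + 1) j (by omega) (by omega),
        add_right_comm, add_assoc]
  rcases le_total i i' with hle | hle
  · have := key (i' - i) i j' (by omega) (by omega)
    rwa [show j' + (i' - i) = j by omega, show i + (i' - i) = i' by omega] at this
  · have := key (i - i') i' j (by omega) (by omega)
    rw [show j + (i - i') = j' by omega, show i' + (i - i') = i by omega] at this
    exact this.symm

end Toric

/-! ### The graded symbol -/

section Graded

open Polynomial

variable {O : Type*} [CommRing O]

/-- The homomorphism `O[ζ] → O[t][c]` that sends `ζ_h` to `c t^h`. -/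
def toricHom (k : ℕ) (O : Type*) [CommRing O] : MvPolynomial (Fin k) O →ₐ[O] O[X][X] :=
  MvPolynomial.aeval (fun i : Fin k => (X * C (X ^ (i.val + 1)) : O[X][X]))

lemma toricHom_X (i : Fin k) : toricHom k O (MvPolynomial.X i) = X * C (X ^ (i.val + 1)) := by
  simp [toricHom]

lemma toricHom_C (f : O) : toricHom k O (MvPolynomial.C f) = C (C f) := by
  simp only [toricHom, MvPolynomial.aeval_C]
  rfl

/-- Two derivations that correspond on the variables `ζ_i` correspond everywhere. -/
lemma toricHom_derivation (D : Derivation O O[X][X] O[X][X])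
    (D' : Derivation O (MvPolynomial (Fin k) O) (MvPolynomial (Fin k) O))
    (h : ∀ i, toricHom k O (D' (MvPolynomial.X i)) = D (X * C (X ^ (i.val + 1))))
    (r : MvPolynomial (Fin k) O) : toricHom k O (D' r) = D (toricHom k O r) := by
  induction r using MvPolynomial.induction_on with
  | C a =>
    rw [MvPolynomial.derivation_C, map_zero, toricHom_C]
    exact (D.map_algebraMap a).symm
  | add p q hp hq => simp only [map_add, hp, hq]
  | mul_X p i hp =>
    rw [Derivation.leibniz, map_add, smul_eq_mul, smul_eq_mul, map_mul, map_mul, map_mul,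
      Derivation.leibniz, h, hp, toricHom_X, smul_eq_mul, smul_eq_mul]

lemma derivation_sum_apply {R A M : Type*} [CommSemiring R] [CommSemiring A] [AddCommMonoid M]
    [Algebra R A] [Module A M] [Module R M] {ι : Type*} (s : Finset ι) (D : ι → Derivation R A M)
    (a : A) : (∑ i ∈ s, D i) a = ∑ i ∈ s, D i a := by
  have := congrFun (map_sum Derivation.coeFnAddMonoidHom D s) a
  rwa [Finset.sum_apply] at this

/-- The degree in `ζ` becomes the exponent of `c`. -/
lemma toricHom_euler (r : MvPolynomial (Fin k) O) :
    toricHom k O (∑ i, MvPolynomial.X i * MvPolynomial.pderiv i r) =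
      X * derivative (toricHom k O r) := by
  have h := toricHom_derivation (k := k)
    (((X : O[X][X]) • (derivative' : Derivation O[X] O[X][X] O[X][X])).restrictScalars O)
    (∑ i, (MvPolynomial.X i : MvPolynomial (Fin k) O) • MvPolynomial.pderiv i) (fun j => by
      change toricHom k O _ = X * derivative _
      rw [derivation_sum_apply, Finset.sum_eq_single j]
      · rw [derivative_mul, derivative_X, derivative_C]
        simp [toricHom_X]
      · intro i _ hi
        simp [MvPolynomial.pderiv_X_of_ne hi.symm]
      · exact fun h => absurd (Finset.mem_univ _) h) r
  rw [derivation_sum_apply] at h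
  exact h

/-- Giving `ζ_h` weight `h`, the total weight becomes the exponent of `t`. -/
lemma toricHom_weight (r : MvPolynomial (Fin k) O) :
    toricHom k O (∑ i : Fin k, ((i.val + 1 : ℕ) : MvPolynomial (Fin k) O) *
      (MvPolynomial.X i * MvPolynomial.pderiv i r)) = thetaT O (toricHom k O r) := by
  have h := toricHom_derivation (k := k) (thetaT O)
    (∑ i : Fin k, (((i.val + 1 : ℕ) : MvPolynomial (Fin k) O) * MvPolynomial.X i) •
      MvPolynomial.pderiv i) (fun j => by
      rw [derivation_sum_apply, Finset.sum_eq_single j]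
      · ext1 n
        rw [coeff_thetaT, Derivation.coe_smul, Pi.smul_apply, MvPolynomial.pderiv_X_self,
          smul_eq_mul, mul_one, map_mul, map_natCast, toricHom_X, ← C_eq_natCast, coeff_C_mul]
        cases n with
        | zero => simp
        | succ n =>
          rw [coeff_X_mul, coeff_C]
          split_ifs
          · simp
            ring
          · simp
      · intro i _ hi
        simp [MvPolynomial.pderiv_X_of_ne hi.symm]
      · exact fun h => absurd (Finset.mem_univ _) h) r
  rw [derivation_sum_apply] at h
  rw [← h]
  congr 1
  exact Finset.sum_congr rfl fun i _ => (mul_assoc _ _ _).symm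

lemma toricHom_suppBound (r : MvPolynomial (Fin k) O) : SuppBound k 0 (toricHom k O r) := by
  induction r using MvPolynomial.induction_on with
  | C a =>
    intro q s h
    rw [toricHom_C, coeff_C] at h
    split_ifs at h with hq
    · rw [coeff_C] at h
      split_ifs at h with hs
      · omega
      · simp at h
    · simp at h
  | add p q hp hq => rw [map_add]; exact hp.add hq
  | mul_X p i hp =>
    rw [map_mul, toricHom_X, mul_comm]
    refine hp.X_mul_C_mul fun s hs => ?_
    rw [coeff_X_pow] at hs
    split_ifs at hs with h
    · have := i.2
      omega
    · simp at hs

variable (k O) in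
/-- The ideal generated by the symbols of the operators `A_{p,q}`. -/
def toricIdeal : Ideal (MvPolynomial (Fin k) O) :=
  Ideal.span {r | ∃ i i' j j' : Fin k, i'.val = i.val + 1 ∧ j.val = j'.val + 1 ∧
    r = MvPolynomial.X i * MvPolynomial.X j - MvPolynomial.X i' * MvPolynomial.X j'}

/-- The coordinates, indexed by natural numbers. -/
def natX (k : ℕ) (O : Type*) [CommRing O] (i : ℕ) : MvPolynomial (Fin k) O :=
  if h : i < k then MvPolynomial.X ⟨i, h⟩ else 0

lemma toricHom_natX {i : ℕ} (h : i < k) : toricHom k O (natX k O i) = X * C (X ^ (i + 1)) := by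
  rw [natX, dif_pos h, toricHom_X]

/-- Indices start at zero while `ζ_h` maps to `c t^h` with `h ≥ 1`, so each of the `q` factors adds
one to the exponent of `t`. -/
lemma toricHom_toricForm (hk : 1 ≤ k) (q s : ℕ) (hs : s ≤ q * (k - 1)) :
    toricHom k O (toricForm (k - 1) (natX k O) q s) = X ^ q * C (X ^ (q + s)) := by
  induction q generalizing s with
  | zero =>
    obtain rfl : s = 0 := by omega
    simp [toricForm]
  | succ q ih =>
    rw [Nat.succ_mul] at hs
    rw [toricForm]
    split_ifs with h
    · rw [map_mul, map_pow, toricHom_natX (by omega), toricHom_natX (by omega)]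
      simp only [map_pow]
      ring
    · rw [map_mul, ih _ (by omega), toricHom_natX (by omega),
        show q + 1 + s = (k - 1 + 1) + (q + (s - (k - 1))) by omega]
      simp only [map_pow]
      ring

/-- Modulo the quadratic relations a monomial depends only on its degree and weight, hence only on
its image. So the quotient map factors through `toricHom`. -/
lemma mem_toricIdeal_of_toricHom_eq_zero {r : MvPolynomial (Fin k) O}
    (h : toricHom k O r = 0) : r ∈ toricIdeal k O := by
  let mk := Ideal.Quotient.mkₐ O (toricIdeal k O)
  let z : ℕ → MvPolynomial (Fin k) O ⧸ toricIdeal k O := fun i => mk (natX k O i)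
  have hz : ∀ i j, i + 1 ≤ k - 1 → j + 1 ≤ k - 1 → z i * z (j + 1) = z (i + 1) * z j := by
    intro i j hi hj
    rw [← map_mul, ← map_mul]
    refine Ideal.Quotient.eq.2 (Ideal.subset_span ?_)
    refine ⟨⟨i, by omega⟩, ⟨i + 1, by omega⟩, ⟨j + 1, by omega⟩, ⟨j, by omega⟩, rfl, rfl, ?_⟩
    rw [natX, natX, natX, natX, dif_pos, dif_pos, dif_pos, dif_pos]
  -- `L` sends `c^q t^s` to the normal form of degree `q` and shifted weight `s - q`; the truncated
  -- subtraction is harmless, as `q ≤ s` on the image of `toricHom`.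
  let L : O[X][X] →ₗ[O] MvPolynomial (Fin k) O ⧸ toricIdeal k O :=
    lsum fun q => lsum fun s => LinearMap.toSpanSingleton O _ (toricForm (k - 1) z q (s - q))
  have hL : ∀ (f : O) (q s : ℕ), L (C (C f) * (X ^ q * C (X ^ (q + s)))) =
      f • toricForm (k - 1) z q s := by
    intro f q s
    have e : (C (C f) * (X ^ q * C (X ^ (q + s))) : O[X][X]) = monomial q (monomial (q + s) f) := by
      rw [← C_mul_X_pow_eq_monomial, ← C_mul_X_pow_eq_monomial, map_mul]
      ring
    rw [e]
    simp only [L, lsum_apply]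
    rw [sum_monomial_index _ _ (by simp), sum_monomial_index _ _ (by simp),
      Nat.add_sub_cancel_left]
    rfl
  have hmon : ∀ (α : Fin k →₀ ℕ) (f : O), ∃ g q s, s ≤ q * (k - 1) ∧
      toricHom k O (MvPolynomial.monomial α f) = C (C g) * (X ^ q * C (X ^ (q + s))) ∧
      mk (MvPolynomial.monomial α f) = g • toricForm (k - 1) z q s := by
    refine MvPolynomial.induction_on_monomial ?_ ?_
    · intro a
      refine ⟨a, 0, 0, Nat.zero_le _, ?_, ?_⟩
      · rw [toricHom_C]
        simp
      · rw [toricForm]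
        exact (mk.commutes a).trans (Algebra.algebraMap_eq_smul_one a)
    · rintro p i ⟨g, q, s, hs, h1, h2⟩
      have hi : i.val ≤ k - 1 := by have := i.2; omega
      refine ⟨g, q + 1, s + i.val, ?_, ?_, ?_⟩
      · rw [Nat.succ_mul]
        omega
      · rw [map_mul, h1, toricHom_X]
        simp only [map_pow]
        ring
      · have hzi : mk (MvPolynomial.X i) = z i.val := by
          simp only [z, natX, dif_pos i.2]
        rw [map_mul, h2, hzi, ← mul_toricForm (eq_of_add_eq hz) hi q s hs, smul_mul_assoc, mul_comm]
  have key : ∀ r, L (toricHom k O r) = mk r := by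
    intro r
    induction r using MvPolynomial.induction_on' with
    | monomial α f =>
      obtain ⟨g, q, s, -, h1, h2⟩ := hmon α f
      rw [h1, h2, hL]
    | add p q hp hq => rw [map_add, map_add, map_add, hp, hq]
  refine Ideal.Quotient.eq_zero_iff_mem.1 ?_
  have := key r
  rw [h, map_zero] at this
  exact this.symm

end Graded

/-! ### Right multiplication by `U_0 - λ` on the stalks of `M_μ` -/

section Stalk

open MvPolynomial

variable {x : Fin k → ℂ}

/-- Taking germs of global operators, as a ring homomorphism. -/
def germHom (x : Fin k → ℂ) : GlobalOp k →+* DGerm x where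
  toFun P := P.germ x
  map_one' := rfl
  map_mul' _ _ := rfl
  map_zero' := rfl
  map_add' _ _ := rfl

lemma germHom_d (i : Fin k) : germHom x (GlobalOp.d i) = dGerm x i := rfl

lemma germHom_σ (i : Fin k) : germHom x (GlobalOp.σ i) = mulHom x (coordGerm x i) := rfl

lemma germHom_C (c : ℂ) : germHom x (GlobalOp.C c) = mulHom x (constGerm x c) := rfl

lemma ofSymbol_mul_C (r : MvPolynomial (Fin k) (HolGerm x)) (c : ℂ) :
    ofSymbol x r * germHom x (GlobalOp.C c) = ofSymbol x (MvPolynomial.C (constGerm x c) * r) := by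
  rw [ofSymbol_C_mul, germHom_C]
  induction r using MvPolynomial.induction_on with
  | C a => rw [ofSymbol_C, ← map_mul, ← map_mul, mul_comm]
  | add p q hp hq => rw [map_add, add_mul, mul_add, hp, hq]
  | mul_X p i hp =>
    have h := congrArg (germHom x) (GlobalOp.C_comm_d c i)
    rw [map_mul, map_mul, germHom_C, germHom_d] at h
    rw [ofSymbol_mul_X, mul_assoc, ← h, ← mul_assoc, hp, mul_assoc]

lemma ofSymbol_mul_E (r : MvPolynomial (Fin k) (HolGerm x)) :
    ofSymbol x r * germHom x (GlobalOp.E k) =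
      ofSymbol x (∑ i, (MvPolynomial.C (coordGerm x i) * r + pderiv i r) * X i) := by
  rw [GlobalOp.E, map_sum, Finset.mul_sum, map_sum]
  refine Finset.sum_congr rfl fun i _ => ?_
  rw [map_mul, germHom_d, germHom_σ, ← mul_assoc, ofSymbol_mul_coordGerm, ofSymbol_mul_X]

lemma ofSymbol_mul_U₀ (r : MvPolynomial (Fin k) (HolGerm x)) :
    ofSymbol x r * germHom x (GlobalOp.U₀ k) =
      ofSymbol x (∑ i : Fin k, ((i.val + 1 : ℕ) : MvPolynomial (Fin k) (HolGerm x)) *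
        ((MvPolynomial.C (coordGerm x i) * r + pderiv i r) * X i)) := by
  rw [GlobalOp.U₀, map_sum, Finset.mul_sum, map_sum]
  refine Finset.sum_congr rfl fun i _ => ?_
  rw [map_mul, map_mul, germHom_d, germHom_σ, map_natCast, ← mul_assoc,
    ← (Nat.cast_commute _ (ofSymbol x r)).eq, mul_assoc, ← mul_assoc (ofSymbol x r),
    ofSymbol_mul_coordGerm, ← ofSymbol_mul_X, ← nsmul_eq_mul, ← nsmul_eq_mul, map_nsmul]

lemma exists_ofSymbol_mul_U₀_sub (r : MvPolynomial (Fin k) (HolGerm x)) (lam : ℂ) :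
    ∃ s, ofSymbol x r * germHom x (GlobalOp.U₀ k - GlobalOp.C lam) = ofSymbol x s ∧
      toricHom k _ s =
        eulerOp (rootPoly (coordGerm x)) (constGerm x lam) (toricHom k _ r) := by
  refine ⟨_, by rw [map_sub, mul_sub, ofSymbol_mul_U₀, ofSymbol_mul_C, ← map_sub], ?_⟩
  rw [eulerOp, map_sub, map_mul, toricHom_C, ← toricHom_weight, X_mul_derivative_rootPoly]
  congr 1
  simp only [map_sum, Finset.mul_sum, Finset.sum_mul]
  rw [← Finset.sum_add_distrib]
  refine Finset.sum_congr rfl fun i _ => ?_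
  simp only [map_mul, map_add, map_natCast, toricHom_X, toricHom_C, map_pow]
  ring

/-- The product `∂_1 ∂_{m-1}` contributes `c^2 t^m = c · (c t^m)`, which supplies the constant term
of `Q`; `E` contributes `c (Q - 1) + c ∂_c`. -/
lemma exists_ofSymbol_mul_genT (r : MvPolynomial (Fin k) (HolGerm x)) (μ : ℂ) {o j j' : Fin k}
    (ho : o.val = 0) (hj : j.val = j'.val + 1) :
    ∃ s, ofSymbol x r * germHom x (GlobalOp.d o * GlobalOp.d j' +
        GlobalOp.d j * (GlobalOp.E k + GlobalOp.C μ)) = ofSymbol x s ∧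
      toricHom k _ s = relOp (rootPoly (coordGerm x)) (constGerm x μ)
        (toricHom k _ r * (Polynomial.X * Polynomial.C (Polynomial.X ^ (j.val + 1)))) := by
  refine ⟨_, by rw [map_add, map_mul, map_mul, map_add, germHom_d, germHom_d, germHom_d, mul_add,
    ← mul_assoc, ← mul_assoc, ← ofSymbol_mul_X, ← ofSymbol_mul_X, ← ofSymbol_mul_X, mul_add,
    ofSymbol_mul_E, ofSymbol_mul_C, ← map_add, ← map_add], ?_⟩
  have e : ∀ s : MvPolynomial (Fin k) (HolGerm x),
      ∑ i, (MvPolynomial.C (coordGerm x i) * s + pderiv i s) * X i =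
      ∑ i, MvPolynomial.C (coordGerm x i) * X i * s + ∑ i, X i * pderiv i s := by
    intro s
    rw [← Finset.sum_add_distrib]
    exact Finset.sum_congr rfl fun i _ => by ring
  rw [e, map_add, map_add, map_add, toricHom_euler, ← toricHom_X, ← map_mul, relOp, map_mul,
    map_mul, map_mul (toricHom k _) (MvPolynomial.C _), toricHom_C, ← Finset.sum_mul,
    map_mul (toricHom k _) (∑ i, _), map_mul (toricHom k _) r, toricHom_X, toricHom_X, toricHom_X,
    ho, hj, map_sum, rootPoly]
  have e2 : ∑ i, toricHom k (HolGerm x) (MvPolynomial.C (coordGerm x i) * X i) =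
      Polynomial.X * Polynomial.C (∑ i : Fin k, Polynomial.C (coordGerm x i) *
        Polynomial.X ^ (i.val + 1)) := by
    rw [map_sum, Finset.mul_sum]
    refine Finset.sum_congr rfl fun i _ => ?_
    rw [map_mul, toricHom_C, toricHom_X, map_mul]
    ring
  rw [e2]
  simp only [map_add, map_one, map_pow]
  ring

/-! ### The stalks of `I_μ` in the graded model -/

lemma germ_mem_idealStalk {G : Set (GlobalOp k)} {P : GlobalOp k} (hP : P ∈ G) (Q : DGerm x) :
    Q * germHom x P ∈ idealStalk G x :=
  Ideal.mul_mem_left _ _ (Ideal.subset_span ⟨P, hP, rfl⟩)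

/-- Multiples of the `A_{p,q}` map to zero and multiples of `T^m_μ` to relations on multiples of `c
t^m`. Here `m ≥ 2` is what gives the lower bound `q + 1 ≤ s`. -/
lemma exists_relOp_of_mem_idealStalk (μ : ℂ) {r : MvPolynomial (Fin k) (HolGerm x)}
    (hr : ofSymbol x r ∈ idealStalk (genI k μ) x) :
    ∃ w, SuppBound k 1 w ∧
      toricHom k _ r = relOp (rootPoly (coordGerm x)) (constGerm x μ) w := by
  -- The left multiplier `a` is carried along so that the induction on the span passes through
  -- scalar multiplication.
  have key : ∀ P ∈ idealStalk (genI k μ) x, ∀ (a : DGerm x) (r : MvPolynomial (Fin k) (HolGerm x)),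
      ofSymbol x r = a * P → ∃ w, SuppBound k 1 w ∧
        toricHom k _ r = relOp (rootPoly (coordGerm x)) (constGerm x μ) w := by
    intro P hP
    induction hP using Submodule.span_induction with
    | mem P hP =>
      obtain ⟨g, hg, rfl⟩ := hP
      intro a r hr
      obtain ⟨s, rfl⟩ := ofSymbol_surjective x a
      rcases hg with ⟨i, i', j, j', hi, hj, rfl⟩ | ⟨o, j, j', ho, hj, rfl⟩
      · refine ⟨0, .zero, ?_⟩
        have h1 : r = s * X i * X j - s * X i' * X j' := by
          apply ofSymbol_injective
          rw [hr, map_sub]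
          change _ * germHom x _ = _
          simp only [ofSymbol_mul_X, map_sub, map_mul, mul_sub, germHom_d]
          simp only [mul_assoc]
        rw [relOp_zero, h1, map_sub]
        simp only [map_mul, toricHom_X, hi, hj, map_pow]
        ring
      · obtain ⟨t, ht, e⟩ := exists_ofSymbol_mul_genT s μ ho hj
        obtain rfl : r = t := ofSymbol_injective (hr.trans ht)
        refine ⟨_, ?_, e⟩
        rw [mul_comm]
        refine (toricHom_suppBound s).X_mul_C_mul fun n hn => ?_
        rw [Polynomial.coeff_X_pow] at hn
        split_ifs at hn with h
        · have := j.2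
          omega
        · simp at hn
    | zero =>
      intro a r hr
      rw [mul_zero] at hr
      exact ⟨0, .zero, by rw [ofSymbol_eq_zero hr, relOp_zero, map_zero]⟩
    | add P Q _ _ hP hQ =>
      intro a r hr
      obtain ⟨s, hs⟩ := ofSymbol_surjective x (a * P)
      obtain ⟨t, ht⟩ := ofSymbol_surjective x (a * Q)
      obtain ⟨v, hv, ev⟩ := hP a s hs
      obtain ⟨w, hw, ew⟩ := hQ a t ht
      obtain rfl : r = s + t := ofSymbol_injective (by rw [hr, mul_add, map_add, hs, ht])
      exact ⟨v + w, hv.add hw, by rw [map_add, ev, ew, relOp_add]⟩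
    | smul b P _ hP =>
      intro a r hr
      exact hP (a * b) r (by rw [hr, smul_eq_mul, mul_assoc])
  exact key _ hr 1 r (one_mul _).symm

/-- By additivity it is enough to treat one monomial of `w`; the bounds let it be written as some `c
t^m` with `2 ≤ m ≤ k` times the image of a monomial in `ζ`. -/
lemma exists_mem_idealStalk_of_suppBound (μ : ℂ) {w : Polynomial (Polynomial (HolGerm x))}
    (hw : SuppBound k 1 w) :
    ∃ r, ofSymbol x r ∈ idealStalk (genI k μ) x ∧
      toricHom k _ r = relOp (rootPoly (coordGerm x)) (constGerm x μ) w := by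
  have hzero : ∃ r, ofSymbol x r ∈ idealStalk (genI k μ) x ∧
      toricHom k _ r = relOp (rootPoly (coordGerm x)) (constGerm x μ) 0 :=
    ⟨0, by rw [map_zero]; exact zero_mem _, by rw [map_zero, relOp_zero]⟩
  have hadd : ∀ v w, (∃ r, ofSymbol x r ∈ idealStalk (genI k μ) x ∧
      toricHom k _ r = relOp (rootPoly (coordGerm x)) (constGerm x μ) v) →
      (∃ r, ofSymbol x r ∈ idealStalk (genI k μ) x ∧
      toricHom k _ r = relOp (rootPoly (coordGerm x)) (constGerm x μ) w) →
      (∃ r, ofSymbol x r ∈ idealStalk (genI k μ) x ∧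
      toricHom k _ r = relOp (rootPoly (coordGerm x)) (constGerm x μ) (v + w)) := by
    rintro v w ⟨r, hr, er⟩ ⟨s, hs, es⟩
    exact ⟨r + s, by rw [map_add]; exact add_mem hr hs, by rw [map_add, er, es, relOp_add]⟩
  have e : w = ∑ q ∈ w.support, ∑ s ∈ (w.coeff q).support,
      Polynomial.monomial q (Polynomial.monomial s ((w.coeff q).coeff s)) := by
    conv_lhs => rw [w.as_sum_support]
    refine Finset.sum_congr rfl fun q _ => ?_
    rw [← map_sum, ← Polynomial.as_sum_support]
  rw [e]
  refine Finset.sum_induction _ (fun w => ∃ r, ofSymbol x r ∈ idealStalk (genI k μ) x ∧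
      toricHom k _ r = relOp (rootPoly (coordGerm x)) (constGerm x μ) w) hadd hzero fun q _ => ?_
  refine Finset.sum_induction _ (fun w => ∃ r, ofSymbol x r ∈ idealStalk (genI k μ) x ∧
      toricHom k _ r = relOp (rootPoly (coordGerm x)) (constGerm x μ) w) hadd hzero fun s hs => ?_
  have hb := hw q s (Polynomial.mem_support_iff.1 hs)
  generalize (w.coeff q).coeff s = f
  cases q with
  | zero => omega
  | succ q =>
    rw [Nat.mul_succ] at hb
    have hk : 2 ≤ k := by
      by_contra! hlt
      interval_cases k <;> omega
    have hkq : k * q = q * (k - 1) + q := by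
      obtain ⟨m, rfl⟩ : ∃ m, k = m + 1 := ⟨k - 1, by omega⟩
      rw [Nat.add_sub_cancel]
      ring
    -- The choice is `m = min k (s - q)`, the largest that leaves `c^q t^(s-m)` with `q ≤ s - m`;
    -- then also `s - m ≤ k q`. In `Fin k` the indices of `m` and `m - 1` are `m - 1` and `m - 2`.
    have hj : min k (s - q) - 1 < k := by omega
    obtain ⟨r, hr, er⟩ := exists_ofSymbol_mul_genT
      (MvPolynomial.C f * toricForm (k - 1) (natX k (HolGerm x)) q (s - min k (s - q) - q)) μ
      (o := ⟨0, by omega⟩) (j := ⟨min k (s - q) - 1, hj⟩) (j' := ⟨min k (s - q) - 2, by omega⟩)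
      rfl (by simp only; omega)
    refine ⟨r, ?_, ?_⟩
    · rw [← hr]
      exact germ_mem_idealStalk (Or.inr ⟨_, _, _, rfl, by simp only; omega, rfl⟩) _
    · rw [er, map_mul, toricHom_C, toricHom_toricForm (by omega) _ _ (by omega),
        ← Polynomial.C_mul_X_pow_eq_monomial, ← Polynomial.C_mul_X_pow_eq_monomial]
      have h3 : s = (q + (s - min k (s - q) - q)) + (min k (s - q) - 1 + 1) := by omega
      conv_rhs => rw [h3]
      refine congrArg (relOp _ _) ?_
      simp only [map_mul, map_pow]
      ring

/-- The `A_{p,q}` have constant coefficients, so multiplying by them on the right is multiplication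
of symbols. -/
lemma ofSymbol_mem_of_mem_toricIdeal (μ : ℂ) {r : MvPolynomial (Fin k) (HolGerm x)}
    (hr : r ∈ toricIdeal k (HolGerm x)) : ofSymbol x r ∈ idealStalk (genI k μ) x := by
  have key : ∀ a, ofSymbol x (a * r) ∈ idealStalk (genI k μ) x := by
    induction hr using Submodule.span_induction with
    | mem r hr =>
      obtain ⟨i, i', j, j', hi, hj, rfl⟩ := hr
      intro a
      have h1 : ofSymbol x (a * (X i * X j - X i' * X j')) = ofSymbol x a * germHom x
          (GlobalOp.d i * GlobalOp.d j - GlobalOp.d i' * GlobalOp.d j') := by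
        rw [mul_sub, ← mul_assoc, ← mul_assoc]
        simp only [ofSymbol_mul_X, map_sub, map_mul, mul_sub, germHom_d]
        simp only [mul_assoc]
      rw [h1]
      exact germ_mem_idealStalk (Or.inl ⟨i, i', j, j', hi, hj, rfl⟩) _
    | zero =>
      intro a
      rw [mul_zero, map_zero]
      exact zero_mem _
    | add p q _ _ hp hq =>
      intro a
      rw [mul_add, map_add]
      exact add_mem (hp a) (hq a)
    | smul b p _ hp =>
      intro a
      rw [smul_eq_mul, ← mul_assoc]
      exact hp _
  rw [← one_mul r]
  exact key 1

/-- Right multiplication by `U_0 - λ` is injective on the stalks of `M_μ`. -/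
theorem mem_idealStalk_of_mul_mem (hk : 1 ≤ k) (μ lam : ℂ) {P : DGerm x}
    (h : P * (GlobalOp.U₀ k - GlobalOp.C lam).germ x ∈ idealStalk (genI k μ) x) :
    P ∈ idealStalk (genI k μ) x := by
  obtain ⟨r, rfl⟩ := ofSymbol_surjective x P
  obtain ⟨s, hs, es⟩ := exists_ofSymbol_mul_U₀_sub r lam
  change ofSymbol x r * germHom x _ ∈ _ at h
  rw [hs] at h
  obtain ⟨w, hw, ew⟩ := exists_relOp_of_mem_idealStalk μ h
  obtain ⟨w', hw', ew'⟩ := exists_relOp_of_eulerOp hk (coeff_zero_rootPoly _)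
    (natDegree_rootPoly _ hk coordGerm_ne_zero) (rootPoly_dvd_of_dvd_X_mul_derivative_mul hk x)
    _ _ (toricHom_suppBound r) hw (es.symm.trans ew)
  -- An element `t` of the ideal with the same image as `r`; the difference has image zero and so
  -- comes from the `A_{p,q}`.
  obtain ⟨t, ht, et⟩ := exists_mem_idealStalk_of_suppBound μ hw'
  have h1 : toricHom k _ (r - t) = 0 := by rw [map_sub, ew', et, sub_self]
  have h2 := ofSymbol_mem_of_mem_toricIdeal μ (mem_toricIdeal_of_toricHom_eq_zero h1)
  rw [map_sub] at h2
  have := add_mem h2 ht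
  rwa [sub_add_cancel] at this

end Stalk

/-! ### Morphisms of sheaves of modules that are injective on sections -/

section SheafOfModules

variable {C : Type*} [Category C] {J : GrothendieckTopology C} {R : Sheaf J RingCat.{0}}
  {A B : SheafOfModules.{0} R}

lemma mono_of_injective_app (f : A ⟶ B) (hf : ∀ U, Function.Injective (f.val.app U)) : Mono f := by
  have : Mono ((SheafOfModules.forget R).map f) := PresheafOfModules.mono_of_injective hf
  exact (SheafOfModules.forget R).mono_of_mono_map this

/-- Injectivity makes the chosen preimages unique, hence automatically linear and compatible with
restriction. -/
lemma exists_lift_of_injective_app (f : A ⟶ B) (hf : ∀ U, Function.Injective (f.val.app U))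
    {W : SheafOfModules.{0} R} (h : W ⟶ B) (hh : ∀ U s, ∃ t, f.val.app U t = h.val.app U s) :
    ∃ l : W ⟶ A, l ≫ f = h := by
  choose t ht using hh
  refine ⟨⟨{ app := fun U => ModuleCat.ofHom
              { toFun := t U
                map_add' := fun a b => hf U (by rw [ht, map_add, map_add, ht, ht])
                map_smul' := fun r a => hf U (by
                  rw [ht, map_smul, RingHom.id_apply, map_smul, ht]) }
             naturality := ?_ }⟩, ?_⟩
  · intro U V i
    ext s
    refine hf V ?_
    exact (ht V _).trans ((PresheafOfModules.naturality_apply h.val i s).trans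
      ((congrArg (B.val.map i) (ht U s)).symm.trans
        (PresheafOfModules.naturality_apply f.val i (t U s)).symm))
  · apply SheafOfModules.hom_ext
    apply PresheafOfModules.hom_ext
    intro U
    ext s
    exact ht U s

end SheafOfModules

/-! ### Local lifting -/

/-- An element of the ideal is a finite combination of germs of global generators; extending its
coefficients extends the membership too. -/
lemma exists_section_mem_idealStalk (G : Set (GlobalOp k)) {x : Fin k → ℂ} {P : DGerm x}
    (hP : P ∈ idealStalk G x) :
    ∃ (U : Opens (N k)) (hx : x ∈ U), ∃ s ∈ finiteOrderOps U, s ⟨x, hx⟩ = P ∧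
      ∀ y : U, s y ∈ idealStalk G y.1 := by
  induction hP using Submodule.span_induction with
  | mem P hP =>
    obtain ⟨g, hg, rfl⟩ := hP
    obtain ⟨V, hV, i, hs⟩ := g.2 ⟨x, trivial⟩
    exact ⟨V, hV, _, hs, rfl, fun y => Ideal.subset_span ⟨g, hg, rfl⟩⟩
  | zero => exact ⟨⊤, trivial, 0, zero_mem _, rfl, fun y => zero_mem _⟩
  | add P Q _ _ hP hQ =>
    obtain ⟨U, hU, s, hs, rfl, hs'⟩ := hP
    obtain ⟨V, hV, t, ht, rfl, ht'⟩ := hQ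
    exact ⟨U ⊓ V, ⟨hU, hV⟩, restrictFam (Opens.infLELeft U V) s +
      restrictFam (Opens.infLERight U V) t, add_mem (restrictFam_mem _ hs) (restrictFam_mem _ ht),
      rfl, fun y => add_mem (hs' ⟨y.1, y.2.1⟩) (ht' ⟨y.1, y.2.2⟩)⟩
  | smul b P _ hP =>
    obtain ⟨U, hU, s, hs, rfl, hs'⟩ := hP
    obtain ⟨V, hV, t, ht, rfl⟩ := exists_section x b
    exact ⟨U ⊓ V, ⟨hU, hV⟩, restrictFam (Opens.infLERight U V) t *
      restrictFam (Opens.infLELeft U V) s, mul_mem (restrictFam_mem _ ht) (restrictFam_mem _ hs),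
      rfl, fun y => Ideal.mul_mem_left _ _ (hs' ⟨y.1, y.2.1⟩)⟩

/-- Membership in the left ideal generated by `G` is an open condition. -/
lemma exists_forall_mem_idealStalk (G : Set (GlobalOp k)) {U : Opens (N k)}
    {s : ∀ x : U, DGerm x.1} (hs : s ∈ finiteOrderOps U) {x : U} (h : s x ∈ idealStalk G x.1) :
    ∃ V : Opens (N k), x.1 ∈ V ∧ ∃ i : V ≤ U, ∀ y : V, s ⟨y.1, i y.2⟩ ∈ idealStalk G y.1 := by
  -- `s` is compared with an extension `t` that stays in the ideal; both have finite order and the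
  -- same germ at `x`, so they agree nearby.
  obtain ⟨W, hx, t, ht, e, ht'⟩ := exists_section_mem_idealStalk G h
  obtain ⟨V, hV, i, h0⟩ := eventually_eq_zero_of_mem_finiteOrderOps
    (sub_mem (restrictFam_mem (Opens.infLELeft U W) hs) (restrictFam_mem (Opens.infLERight U W) ht))
    (x := ⟨x.1, ⟨x.2, hx⟩⟩) (by
      change s x - t ⟨x.1, hx⟩ = 0
      rw [e, sub_self])
  refine ⟨V, hV, fun y hy => (i hy).1, fun y => ?_⟩
  have h1 : s ⟨y.1, (i y.2).1⟩ = t ⟨y.1, (i y.2).2⟩ := sub_eq_zero.1 (h0 y)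
  rw [h1]
  exact ht' ⟨y.1, (i y.2).2⟩

/-! ### Exactness on stalks and lifting of sections -/

lemma rightMulStalk_mk (G G' : Set (GlobalOp k)) (Q : GlobalOp k)
    (h : ∀ g ∈ G, ∀ x, (g * Q).germ x ∈ idealStalk G' x) (x : Fin k → ℂ) (P : DGerm x) :
    rightMulStalk G G' Q h x (QStalk.mk G x P) = QStalk.mk G' x (P * Q.germ x) := rfl

lemma QStalk.mk_eq_mk {G : Set (GlobalOp k)} {x : Fin k → ℂ} {P Q : DGerm x} :
    QStalk.mk G x P = QStalk.mk G x Q ↔ P - Q ∈ idealStalk G x :=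
  Submodule.Quotient.eq (idealStalk G x)

lemma QStalk.mk_surjective (G : Set (GlobalOp k)) (x : Fin k → ℂ) :
    Function.Surjective (QStalk.mk G x) :=
  Submodule.mkQ_surjective (idealStalk G x)

lemma rightMulStalk_injective (hk : 1 ≤ k) (μ lam : ℂ) (x : Fin k → ℂ) :
    Function.Injective (rightMulStalk _ _ (GlobalOp.U₀ k - GlobalOp.C lam) (genI_mul_mem μ lam) x) := by
  intro a b hab
  obtain ⟨P, rfl⟩ := QStalk.mk_surjective _ _ a
  obtain ⟨Q, rfl⟩ := QStalk.mk_surjective _ _ b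
  rw [rightMulStalk_mk, rightMulStalk_mk, QStalk.mk_eq_mk, ← sub_mul] at hab
  exact QStalk.mk_eq_mk.2 (mem_idealStalk_of_mul_mem hk μ lam hab)

lemma exists_rightMulStalk_eq (μ lam : ℂ) (x : Fin k → ℂ) (a : QStalk (genI k μ) x)
    (ha : rightMulStalk _ _ 1 (genI_mul_one_mem μ lam) x a = 0) :
    ∃ b, rightMulStalk _ _ (GlobalOp.U₀ k - GlobalOp.C lam) (genI_mul_mem μ lam) x b = a := by
  obtain ⟨P, rfl⟩ := QStalk.mk_surjective _ _ a
  have h1 : (1 : GlobalOp k).germ x = 1 := rfl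
  rw [rightMulStalk_mk, h1, mul_one, ← map_zero (QStalk.mk _ x), QStalk.mk_eq_mk, sub_zero,
    idealStalk, genJ, Set.image_union, Set.image_singleton, Ideal.span_union,
    Submodule.mem_sup] at ha
  obtain ⟨A, hA, B, hB, rfl⟩ := ha
  obtain ⟨D, rfl⟩ := Ideal.mem_span_singleton'.1 hB
  refine ⟨QStalk.mk _ x D, ?_⟩
  rw [rightMulStalk_mk, QStalk.mk_eq_mk, sub_add_cancel_right]
  exact neg_mem hA

/-- Stalkwise preimages are unique by injectivity, so the one at `x`, extended to a section, must
agree with those at nearby points. -/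
lemma exists_mapH_eq (hk : 1 ≤ k) (μ lam : ℂ) {U : Opens (N k)} (s : QSec (genI k μ) U)
    (hs : ∀ x : U, rightMulStalk _ _ 1 (genI_mul_one_mem μ lam) x.1 (s.1 x) = 0) :
    ∃ t : QSec (genI k μ) U, ∀ x : U,
      rightMulStalk _ _ (GlobalOp.U₀ k - GlobalOp.C lam) (genI_mul_mem μ lam) x.1 (t.1 x) = s.1 x := by
  choose t ht using fun x : U => exists_rightMulStalk_eq μ lam x.1 (s.1 x) (hs x)
  refine ⟨⟨t, fun x => ?_⟩, ht⟩
  obtain ⟨V, hxV, i, P, hP⟩ := s.2 x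
  obtain ⟨V₁, hxV₁, i₁, hP₁⟩ := P.2 ⟨x.1, hxV⟩
  obtain ⟨V₂, hxV₂, i₂, hu⟩ := (GlobalOp.U₀ k - GlobalOp.C lam).2 ⟨x.1, trivial⟩
  obtain ⟨B, hB⟩ := QStalk.mk_surjective _ _ (t x)
  obtain ⟨V₃, hxV₃, b, hb, rfl⟩ := exists_section x.1 B
  let W : Opens (N k) := V₁ ⊓ V₂ ⊓ V₃
  have hW₁ : W ≤ V₁ := inf_le_left.trans inf_le_left
  have hW₂ : W ≤ V₂ := inf_le_left.trans inf_le_right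
  have hW₃ : W ≤ V₃ := inf_le_right
  -- With `b` extending a representative of the preimage at `x`, the operator `b (U_0 - λ) - P` lies
  -- in the ideal at `x`, hence at all nearby points.
  have hdiff := sub_mem (mul_mem (restrictFam_mem (homOfLE hW₃) hb)
    (restrictFam_mem (homOfLE hW₂) hu)) (restrictFam_mem (homOfLE hW₁) hP₁)
  have hPs : ∀ y : V, s.1 ⟨y.1, i.le y.2⟩ = QStalk.mk _ y.1 (P.1 y) := fun y => congrFun hP y
  have hx := ht x
  rw [← hB, rightMulStalk_mk] at hx
  have hx' := QStalk.mk_eq_mk.1 (hx.trans (hPs ⟨x.1, hxV⟩))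
  obtain ⟨W', hxW', j, hW'⟩ := exists_forall_mem_idealStalk (genI k μ) hdiff
    (x := ⟨x.1, ⟨⟨hxV₁, hxV₂⟩, hxV₃⟩⟩) hx'
  have hW'U : W' ≤ U := j.trans (hW₁.trans (i₁.le.trans i.le))
  refine ⟨W', hxW', homOfLE hW'U, ⟨restrictFam (homOfLE (j.trans hW₃)) b,
    TopCat.PrelocalPredicate.sheafifyOf (restrictFam_mem _ hb)⟩, ?_⟩
  funext y
  refine rightMulStalk_injective hk μ lam y.1 ?_
  refine (ht ⟨y.1, hW'U y.2⟩).trans ((hPs ⟨y.1, i₁.le (hW₁ (j y.2))⟩).trans ?_)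
  exact (QStalk.mk_eq_mk.2 (hW' y)).symm

/-! ### The short exact sequence -/

lemma mapH_app_injective (hk : 1 ≤ k) (μ lam : ℂ) (U : (Opens (N k))ᵒᵖ) :
    Function.Injective ((mapH k μ lam).val.app U) := by
  intro s t hst
  refine Subtype.ext (funext fun x => ?_)
  exact rightMulStalk_injective hk μ lam x.1
    (congrFun (congrArg (fun u : QSec (genI k μ) U.unop => u.1) hst) x)

lemma epi_mapq (μ lam : ℂ) : Epi (mapq k μ lam) := by
  have : Sheaf.IsLocallySurjective ((SheafOfModules.toSheaf _).map (mapq k μ lam)) := by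
    constructor
    intro U s x hx
    -- A section of the quotient is locally the class of an operator `P`, whose class in `M_μ` is a
    -- local preimage.
    obtain ⟨V, hxV, i, P, hP⟩ := (show QSec (genJ k μ lam) U from s).2 ⟨x, hx⟩
    refine ⟨V, i, ⟨(⟨classFam (genI k μ) P, TopCat.PrelocalPredicate.sheafifyOf ⟨P, rfl⟩⟩ :
      QSec (genI k μ) V), ?_⟩, hxV⟩
    refine Subtype.ext (funext fun y => ?_)
    refine Eq.trans ?_ (congrFun hP y).symm
    exact congrArg (QStalk.mk _ y.1) (mul_one (P.1 y))
  exact (SheafOfModules.toSheaf _).epi_of_epi_map inferInstance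

/-- The sequence `0 → M_μ → M_μ → N_{μ,λ} → 0` is exact. -/
lemma sequenceMMN_shortExact (hk : 1 ≤ k) (μ lam : ℂ) : (sequenceMMN k μ lam).ShortExact := by
  have hinj := mapH_app_injective hk μ lam
  have hmono : Mono (mapH k μ lam) := mono_of_injective_app _ hinj
  have : Mono (sequenceMMN k μ lam).f := hmono
  have hepi : Epi (sequenceMMN k μ lam).g := epi_mapq μ lam
  refine ⟨?_⟩
  -- A morphism killed by the quotient map lifts sectionwise through the injective map, which is
  -- therefore a kernel.
  refine ShortComplex.exact_of_f_is_kernel _ (Limits.KernelFork.IsLimit.ofι' _ _ fun {W} h hh => ?_)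
  have hex := exists_lift_of_injective_app (mapH k μ lam) hinj h (fun U s => by
    have h0 := ConcreteCategory.congr_hom
      (congrArg (fun f : W ⟶ moduleN k μ lam => f.val.app U) hh) s
    obtain ⟨t, ht⟩ := exists_mapH_eq hk μ lam (show QSec (genI k μ) U.unop from h.val.app U s)
      (fun x => congrFun (congrArg (fun u : QSec (genJ k μ lam) U.unop => u.1) h0) x)
    exact ⟨t, Subtype.ext (funext ht)⟩)
  exact ⟨hex.choose, hex.choose_spec⟩

end MuTrace

end

theorem proposition3p1p1 (k : ℕ) (hk : 1 ≤ k) (μ lam : ℂ) :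
    (∀ U : (TopologicalSpace.Opens (MuTrace.N k))ᵒᵖ,
      Function.Injective ((MuTrace.mapH k μ lam).val.app U)) ∧
    (MuTrace.sequenceMMN k μ lam).ShortExact :=
  ⟨MuTrace.mapH_app_injective hk μ lam, MuTrace.sequenceMMN_shortExact hk μ lam⟩
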